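/- Let $K$ be a field that is complete with respect to a nontrivial non-archimedean absolute value $|\cdot|$, algebraically closed, and whose residue field has characteristic $2$. Then there are $a,b\in K$ with $|a|>1$ and $|b|=1$, and with $|a|=|2|^{-1}$ if $K$ has characteristic $0$ (so $|a|=2$ when the absolute value is normalized by $|2|=\tfrac12$), such that the Fatou set of the quadratic rational map $$R(z)=\frac{z^2-z}{bz-\frac1a}$$ of $\mathbb{P}^1(K)$ has a wandering component $U$. Moreover, $U$ contains a disk $D=\{z\in K:|z-x|<r\}$, with $x\in K$ and $r>0$, all of whose forward images $R^n(D)$, $n\ge 0$, are disks $\{z\in K:|z-y_n|<s_n\}$ with $y_n\in K$ and $s_n>0$, and these images are pairwise disjoint. Here the Fatou set is the set of the points of $\mathbb{P}^1(K)$ that have a neighbourhood on which the iterates of $R$ are equicontinuous for the chordal metric. A disk of $\mathbb{P}^1(K)$ is a set $\{z\in K:|z-c|<\rho\}$ or $\{z\in K:|z-c|\le\rho\}$ with $c\in K$ and $\rho>0$, or the complement in $\mathbb{P}^1(K)$ of such a set. A connected affinoid is a nonempty subset of $\mathbb{P}^1(K)$ whose complement is a finite union of disks of $\mathbb{P}^1(K)$.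 The component of a set $X\subseteq\mathbb{P}^1(K)$ containing $x\in X$ is the union of all connected affinoids $W$ with $x\in W\subseteq X$. A component $U$ of the Fatou set is wandering if it is not preperiodic, that is, if $R^m(U)\ne R^n(U)$ for all $0\le m<n$. -/

import Mathlib

/-! Dynamics on the projective line `ℙ¹(K)` over a normed field `K`, modelled on the set
`OnePoint K = K ∪ {∞}`. The topology that Mathlib puts on `OnePoint K` is not used: the only
metric structure on `ℙ¹(K)` is the chordal distance defined below. -/

noncomputable section

/-- The chordal distance on `ℙ¹(K)`, in affine coordinates:
`‖z - w‖ / (max 1 ‖z‖ * max 1 ‖w‖)` for `z w : K`, and `1 / max 1 ‖z‖` between `z` and `∞`. -/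
def chordalDist {K : Type*} [NormedField K] (x y : OnePoint K) : ℝ :=
  OnePoint.elim x
    (OnePoint.elim y 0 (fun w => 1 / max 1 ‖w‖))
    (fun z => OnePoint.elim y (1 / max 1 ‖z‖)
      (fun w => ‖z - w‖ / (max 1 ‖z‖ * max 1 ‖w‖)))

/-- The iterates of `f` are equicontinuous at the point `x`, for the chordal distance. -/
def EquicontinuousIteratesAt {K : Type*} [NormedField K] (f : OnePoint K → OnePoint K)
    (x : OnePoint K) : Prop :=
  ∀ ε : ℝ, 0 < ε → ∃ δ : ℝ, 0 < δ ∧ ∀ y : OnePoint K, chordalDist x y < δ →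
    ∀ n : ℕ, chordalDist (f^[n] x) (f^[n] y) < ε

/-- The Fatou set of `f`: the points that have a neighbourhood on which the iterates of `f` form
an equicontinuous family. -/
def fatouSet {K : Type*} [NormedField K] (f : OnePoint K → OnePoint K) : Set (OnePoint K) :=
  {x | ∃ r : ℝ, 0 < r ∧ ∀ y : OnePoint K, chordalDist x y < r → EquicontinuousIteratesAt f y}

/-- The affine open disk `D_r(a) = {z ∈ K : ‖z - a‖ < r}`, as a subset of `ℙ¹(K)`. -/
def openDisk {K : Type*} [NormedField K] (a : K) (r : ℝ) : Set (OnePoint K) :=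
  (fun z : K => (z : OnePoint K)) '' {z : K | ‖z - a‖ < r}

/-- The affine closed disk `B_r(a) = {z ∈ K : ‖z - a‖ ≤ r}`, as a subset of `ℙ¹(K)`. -/
def closedDisk {K : Type*} [NormedField K] (a : K) (r : ℝ) : Set (OnePoint K) :=
  (fun z : K => (z : OnePoint K)) '' {z : K | ‖z - a‖ ≤ r}

/-- A disk of `ℙ¹(K)`: an open or closed affine disk of positive radius, or the complement of
one. -/
def IsProjectiveDisk {K : Type*} [NormedField K] (D : Set (OnePoint K)) : Prop :=
  ∃ (a : K) (r : ℝ), 0 < r ∧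
    (D = openDisk a r ∨ D = closedDisk a r ∨ D = (openDisk a r)ᶜ ∨ D = (closedDisk a r)ᶜ)

/-- A connected affinoid of `ℙ¹(K)`: a nonempty set whose complement is a finite union of
disks. -/
def IsConnectedAffinoid {K : Type*} [NormedField K] (W : Set (OnePoint K)) : Prop :=
  W.Nonempty ∧ ∃ S : Set (Set (OnePoint K)), S.Finite ∧ (∀ D ∈ S, IsProjectiveDisk D) ∧
    Wᶜ = ⋃₀ S

/-- The (analytic) component of `X ⊆ ℙ¹(K)` that contains `x`: the union of all connected
affinoids that contain `x` and are contained in `X`. -/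
def analyticComponent {K : Type*} [NormedField K] (X : Set (OnePoint K)) (x : OnePoint K) :
    Set (OnePoint K) :=
  ⋃₀ {W | IsConnectedAffinoid W ∧ x ∈ W ∧ W ⊆ X}

/-- `U` is a component of the Fatou set of `f`. -/
def IsFatouComponent {K : Type*} [NormedField K] (f : OnePoint K → OnePoint K)
    (U : Set (OnePoint K)) : Prop :=
  ∃ x ∈ fatouSet f, U = analyticComponent (fatouSet f) x

/-- `U` is preperiodic under `f`: `f^m(U) = f^n(U)` for some `m < n`. -/
def IsPreperiodicSet {K : Type*} (f : OnePoint K → OnePoint K) (U : Set (OnePoint K)) : Prop :=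
  ∃ m n : ℕ, m < n ∧ f^[m] '' U = f^[n] '' U

/-- `U` is a wandering component of the Fatou set of `f`: a component that is not preperiodic. -/
def IsWanderingComponent {K : Type*} [NormedField K] (f : OnePoint K → OnePoint K)
    (U : Set (OnePoint K)) : Prop :=
  IsFatouComponent f U ∧ ¬ IsPreperiodicSet f U

open Classical in
/-- The self-map of `ℙ¹(K)` given by the rational function
`R(z) = (z ^ 2 - z) / (b * z - 1 / a)`. For `a ≠ 0` and `a * b ≠ 1` the numerator and denominator
have no common zero, so a zero of the denominator is a pole; the degree of the numerator is the
larger one, so `∞` is fixed. -/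
def quadRatMap {K : Type*} [Field K] (a b : K) (x : OnePoint K) : OnePoint K :=
  OnePoint.elim x OnePoint.infty
    (fun z => if b * z - 1 / a = 0 then OnePoint.infty
      else (((z ^ 2 - z) / (b * z - 1 / a) : K) : OnePoint K))

end

/-! With `B = b⁻¹` and `κ = -(a b)⁻¹` the map is `f(z) = B (z² - z) / (z + κ)`.
Choose `c` with `‖2‖ ≤ ‖c‖² < 1` (with equality in characteristic `0`), put `p = ‖c‖`,
and take `‖B‖ = 1`, `‖κ‖ = p²`. Then `f` expands the disk `‖z‖ < p²` around
its fixed point `0` by the factor `p⁻²`, maps the residue disk of `1` isometrically onto that of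
`0`, and maps the circle `‖z‖ = p` into the unit circle, with a critical point near `c`,
around which it contracts strongly because `2` is small (wild ramification).

*A criterion* (`wandering_of_orbit`). Suppose that the orbit of `x` stays in these three regions,
that the images of a disk `D` around `x` stay of radius at most `p²`, and that for every `d` there
is a time `T ≥ d` such that during the last `d` steps before `T` the orbit is pushed away from `0`
and arrives on the circle `‖z‖ = p`. The iterates are then uniformly Lipschitz on `D`, so `D` lies
in the Fatou set. The circle `‖z‖ = p` has infinitely many residue classes that contain iterated
preimages of the repelling point `0`, which is not in the Fatou set. An affinoid has only finitely
many holes, so, pulled back along the orbit, these classes confine the Fatou component `U` of `x`: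
the whole of `f^T(U)` lies in `‖z‖ = p`. As `f^(T - j)(x)` has absolute value `p ^ (1 + 2 j)`, no
two of the sets `f^n(U)` can be equal.

*The orbit* (`exists_param`). The coefficient `B` is tied to `κ` so that `f(c) = 1 + c³ + c⁴`; then
the third iterate maps a neighbourhood of `c` to itself, almost fixes `c`, and outside the disk of
radius `p³` squares the rescaled distance `‖z - c‖ / p³`. A starting point at a suitable
distance from `c` thus returns `M` times before it comes to distance `p²`, and on the way disks
around it shrink by the factor `p ^ (2 M)`, up to a constant (`Near.orbitRad_passage`). By adjusting
`κ`, the orbit is then made to hit `1`, hence `0`, exactly (`Stage.exists_passage`: a rational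
function whose absolute value is not constant on a disk has a zero there). A perturbation of `κ` of
size less than `p ^ (2 M)` turns this into a run of `M` steps away from `0`, during which the disks
grow back by the factor `p ^ (-2 M)` gained before. All along, the dependence of the orbit on `κ` is
known exactly: the contraction erases the earlier dependence and the exit from the neighbourhood of
`c` renews it as an isometry (`Passage.norm_exit_sub`), so that after the run the orbit point, as a
function of `κ`, is a similarity of a smaller disk of parameters onto the open unit disk, and the
construction can be repeated with a larger `M` (`Stage.exists_next`). The nested disks of parameters
shrink to the parameter that is wanted. -/

noncomputable section

/-! ### Ultrametric norms -/

section Ultrametric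

variable {K : Type*} [NormedField K] [IsUltrametricDist K]

theorem ultrametric_add_lt {x y : K} {r : ℝ} (hx : ‖x‖ < r) (hy : ‖y‖ < r) : ‖x + y‖ < r :=
  (IsUltrametricDist.norm_add_le_max x y).trans_lt (max_lt hx hy)

theorem ultrametric_add_le {x y : K} {r : ℝ} (hx : ‖x‖ ≤ r) (hy : ‖y‖ ≤ r) : ‖x + y‖ ≤ r :=
  (IsUltrametricDist.norm_add_le_max x y).trans (max_le hx hy)

theorem ultrametric_sub_lt {x y : K} {r : ℝ} (hx : ‖x‖ < r) (hy : ‖y‖ < r) : ‖x - y‖ < r := by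
  rw [sub_eq_add_neg]; exact ultrametric_add_lt hx (by rwa [norm_neg])

theorem ultrametric_sub_le {x y : K} {r : ℝ} (hx : ‖x‖ ≤ r) (hy : ‖y‖ ≤ r) : ‖x - y‖ ≤ r := by
  rw [sub_eq_add_neg]; exact ultrametric_add_le hx (by rwa [norm_neg])

theorem norm_add_eq_of_lt {x y : K} (h : ‖y‖ < ‖x‖) : ‖x + y‖ = ‖x‖ := by
  rw [IsUltrametricDist.norm_add_eq_max_of_norm_ne_norm h.ne', max_eq_left h.le]

theorem norm_eq_of_norm_sub_lt {x y : K} (h : ‖x - y‖ < ‖y‖) : ‖x‖ = ‖y‖ := by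
  have := norm_add_eq_of_lt h
  rwa [add_sub_cancel] at this

end Ultrametric

/-! ### Rational functions on disks -/

section Rational

variable {K : Type*} [NormedField K]

/-- `G` agrees on `s` with a rational function that has no pole in `s`. -/
def RatOn (s : Set K) (G : K → K) : Prop :=
  ∃ P Q : Polynomial K, ∀ t ∈ s, Q.eval t ≠ 0 ∧ G t = P.eval t / Q.eval t

namespace RatOn

variable {s : Set K} {G H : K → K}

theorem mono {t : Set K} (h : RatOn s G) (hst : t ⊆ s) : RatOn t G := by
  obtain ⟨P, Q, hPQ⟩ := h
  exact ⟨P, Q, fun x hx => hPQ x (hst hx)⟩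

theorem eval (s : Set K) (P : Polynomial K) : RatOn s fun t => P.eval t :=
  ⟨P, 1, fun t _ => by simp⟩

theorem const (s : Set K) (a : K) : RatOn s fun _ => a := by
  simpa using eval s (Polynomial.C a)

theorem id (s : Set K) : RatOn s fun t => t := by
  simpa using eval s Polynomial.X

theorem add (hG : RatOn s G) (hH : RatOn s H) : RatOn s fun t => G t + H t := by
  obtain ⟨P, Q, h⟩ := hG
  obtain ⟨P', Q', h'⟩ := hH
  refine ⟨P * Q' + P' * Q, Q * Q', fun t ht => ?_⟩
  have h1 := h t ht
  have h2 := h' t ht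
  have h3 := h1.1
  have h4 := h2.1
  refine ⟨by simp [h3, h4], ?_⟩
  simp only [h1.2, h2.2, Polynomial.eval_add, Polynomial.eval_mul]
  field_simp

theorem mul (hG : RatOn s G) (hH : RatOn s H) : RatOn s fun t => G t * H t := by
  obtain ⟨P, Q, h⟩ := hG
  obtain ⟨P', Q', h'⟩ := hH
  refine ⟨P * P', Q * Q', fun t ht => ?_⟩
  have h1 := h t ht
  have h2 := h' t ht
  refine ⟨by simp [h1.1, h2.1], ?_⟩
  simp only [h1.2, h2.2, Polynomial.eval_mul, div_mul_div_comm]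

theorem sub (hG : RatOn s G) (hH : RatOn s H) : RatOn s fun t => G t - H t := by
  have := hG.add ((const s (-1)).mul hH)
  refine (funext fun t => ?_ : (fun t => G t - H t) = _) ▸ this
  ring

theorem inv (hG : RatOn s G) (h0 : ∀ t ∈ s, G t ≠ 0) : RatOn s fun t => (G t)⁻¹ := by
  obtain ⟨P, Q, h⟩ := hG
  refine ⟨Q, P, fun t ht => ⟨fun hP => h0 t ht ?_, ?_⟩⟩
  · rw [(h t ht).2, hP, zero_div]
  · simp only [(h t ht).2, inv_div]

theorem div (hG : RatOn s G) (hH : RatOn s H) (h0 : ∀ t ∈ s, H t ≠ 0) :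
    RatOn s fun t => G t / H t := by
  simpa only [div_eq_mul_inv] using hG.mul (hH.inv h0)

end RatOn

/-- A polynomial over an algebraically closed field has constant absolute value on every subset
that is closer to itself than to the roots. -/
theorem norm_eval_eq_of_forall_root [IsAlgClosed K] (P : Polynomial K) {x y : K}
    (h : ∀ r, P.IsRoot r → ‖x - r‖ = ‖y - r‖) : ‖P.eval x‖ = ‖P.eval y‖ := by
  rcases eq_or_ne P 0 with rfl | hP
  · simp
  have hs : P.Splits := IsAlgClosed.splits P
  rw [hs.eval_eq_prod_roots, hs.eval_eq_prod_roots, norm_mul, norm_mul]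
  congr 1
  have key : ∀ z : K, ‖(P.roots.map fun a => z - a).prod‖ =
      (P.roots.map fun a => ‖z - a‖).prod := by
    intro z
    have := map_multiset_prod (normHom (α := K)) (P.roots.map fun a => z - a)
    simpa [Multiset.map_map, Function.comp_def] using this
  rw [key, key]
  congr 1
  refine Multiset.map_congr rfl fun r hr => h r ?_
  exact (Polynomial.mem_roots hP).1 hr

/-- A rational function without zeros and poles in a disk has constant absolute value there. The
disk is described by the one property that matters: a point outside it has the same distance to
all of its points. -/
theorem RatOn.exists_zero [IsAlgClosed K] {s : Set K} {G : K → K} (hG : RatOn s G)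
    (hs : ∀ r ∉ s, ∀ x ∈ s, ∀ y ∈ s, ‖x - r‖ = ‖y - r‖) {x y : K} (hx : x ∈ s) (hy : y ∈ s)
    (hne : ‖G x‖ ≠ ‖G y‖) : ∃ t ∈ s, G t = 0 := by
  obtain ⟨P, Q, h⟩ := hG
  by_contra! hcon
  apply hne
  rw [(h x hx).2, (h y hy).2, norm_div, norm_div]
  congr 1
  · refine norm_eval_eq_of_forall_root P fun r hr => hs r (fun hrs => hcon r hrs ?_) x hx y hy
    rw [(h r hrs).2, hr.eq_zero, zero_div]
  · exact norm_eval_eq_of_forall_root Q fun r hr =>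
      hs r (fun hrs => (h r hrs).1 hr.eq_zero) x hx y hy

theorem norm_sub_eq_of_notMem_ball [IsUltrametricDist K] {a : K} {R : ℝ} {r : K}
    (hr : r ∉ {t : K | ‖t - a‖ < R}) :
    ∀ x ∈ {t : K | ‖t - a‖ < R}, ∀ y ∈ {t : K | ‖t - a‖ < R}, ‖x - r‖ = ‖y - r‖ := by
  have key : ∀ x ∈ {t : K | ‖t - a‖ < R}, ‖x - r‖ = ‖a - r‖ := by
    intro x hx
    simp only [Set.mem_ofPred_eq, not_lt] at hx hr
    apply norm_eq_of_norm_sub_lt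
    rw [sub_sub_sub_cancel_right, norm_sub_rev a r]
    exact hx.trans_le hr
  intro x hx y hy
  rw [key x hx, key y hy]

theorem norm_sub_eq_of_notMem_closedBall [IsUltrametricDist K] {a : K} {R : ℝ} {r : K}
    (hr : r ∉ {t : K | ‖t - a‖ ≤ R}) :
    ∀ x ∈ {t : K | ‖t - a‖ ≤ R}, ∀ y ∈ {t : K | ‖t - a‖ ≤ R}, ‖x - r‖ = ‖y - r‖ := by
  have key : ∀ x ∈ {t : K | ‖t - a‖ ≤ R}, ‖x - r‖ = ‖a - r‖ := by
    intro x hx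
    simp only [Set.mem_ofPred_eq, not_le] at hx hr
    apply norm_eq_of_norm_sub_lt
    rw [sub_sub_sub_cancel_right, norm_sub_rev a r]
    exact hx.trans_lt hr
  intro x hx y hy
  rw [key x hx, key y hy]

end Rational

/-! ### Disks under a quadratic rational map -/

section QuadraticMap

variable {K : Type*} [NormedField K]

/-- The rational function `B (z² - z) / (z + κ)` on the affine line, with the junk value `0` at
its pole `-κ`. -/
def qmap (B κ z : K) : K := B * (z ^ 2 - z) / (z + κ)

/-- The factor by which `qmap B κ` stretches a disk of radius `ρ` centred at `z`, when `‖B‖ = 1`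
and the disk avoids the pole. -/
def stretch (κ z : K) (ρ : ℝ) : ℝ :=
  max ‖z ^ 2 + 2 * κ * z - κ‖ (‖z + κ‖ * ρ) / ‖z + κ‖ ^ 2

theorem qmap_sub_qmap (B : K) {κ z w : K} (hz : z + κ ≠ 0) (hw : w + κ ≠ 0) :
    qmap B κ z - qmap B κ w =
      B * (z - w) * (z * w + κ * (z + w) - κ) / ((z + κ) * (w + κ)) := by
  unfold qmap
  field_simp
  ring

theorem norm_qmap_sub {B : K} (hB : ‖B‖ = 1) {κ z w : K} (hz : z + κ ≠ 0) (hw : w + κ ≠ 0) :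
    ‖qmap B κ z - qmap B κ w‖ =
      ‖z - w‖ * ‖z * w + κ * (z + w) - κ‖ / (‖z + κ‖ * ‖w + κ‖) := by
  rw [qmap_sub_qmap B hz hw, norm_div, norm_mul, norm_mul, norm_mul, hB, one_mul]

theorem stretch_pos {κ z : K} (hz : z + κ ≠ 0) {ρ : ℝ} (hρ : 0 < ρ) : 0 < stretch κ z ρ := by
  have : 0 < ‖z + κ‖ := norm_pos_iff.2 hz
  unfold stretch
  have h2 : 0 < ‖z + κ‖ * ρ := by positivity
  have := h2.trans_le (le_max_right ‖z ^ 2 + 2 * κ * z - κ‖ _)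
  positivity

/-- Factorization of a monic quadratic polynomial, in a form that does not need division by `2`. -/
theorem exists_roots [IsAlgClosed K] (s d : K) : ∃ x y : K, x + y = s ∧ x * y = d := by
  obtain ⟨x, hx⟩ := IsAlgClosed.exists_root
    (Polynomial.X ^ 2 + (Polynomial.C (-s) * Polynomial.X + Polynomial.C d)) (by
      rw [Polynomial.degree_add_eq_left_of_degree_lt]
      · simp
      · refine (Polynomial.degree_linear_le).trans_lt ?_
        simp)
  refine ⟨x, s - x, by ring, ?_⟩
  have : x ^ 2 + (-s * x + d) = 0 := by simpa [Polynomial.IsRoot] using hx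
  linear_combination -this

theorem exists_roots_norm_le [IsAlgClosed K] (s d : K) :
    ∃ x y : K, x + y = s ∧ x * y = d ∧ ‖x‖ ≤ ‖y‖ := by
  obtain ⟨x, y, h, h'⟩ := exists_roots s d
  rcases le_total ‖x‖ ‖y‖ with hxy | hxy
  · exact ⟨x, y, h, h', hxy⟩
  · exact ⟨y, x, by rw [add_comm, h], by rw [mul_comm, h'], hxy⟩

/-- The equation `qmap B κ (z₀ + x) = t` is quadratic in `x`; here `y` is the other root. -/
theorem qmap_add_eq {B κ z₀ t x y : K} (hB : B ≠ 0) (hP : z₀ + κ ≠ 0) (hx : z₀ + x + κ ≠ 0)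
    (hs : x + y = (t - qmap B κ z₀) / B - (z₀ ^ 2 + 2 * κ * z₀ - κ) / (z₀ + κ))
    (hd : x * y = -((t - qmap B κ z₀) / B * (z₀ + κ))) : qmap B κ (z₀ + x) = t := by
  set s := (t - qmap B κ z₀) / B with hsdef
  have ht : t = qmap B κ z₀ + B * s := by rw [hsdef]; field_simp; ring
  clear_value s
  have h2 : (z₀ + κ) * (x + y) = s * (z₀ + κ) - (z₀ ^ 2 + 2 * κ * z₀ - κ) := by
    rw [hs]; field_simp
  rw [ht, ← sub_eq_iff_eq_add', qmap_sub_qmap B hx hP, div_eq_iff (mul_ne_zero hx hP)]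
  linear_combination B * (x * h2 - (z₀ + κ) * hd)

theorem mul_stretch {κ z₀ : K} (hP : 0 < ‖z₀ + κ‖) {ρ : ℝ} (hρ : 0 < ρ) :
    ρ * stretch κ z₀ ρ * ‖z₀ + κ‖ =
      max (‖z₀ ^ 2 + 2 * κ * z₀ - κ‖ * ρ / ‖z₀ + κ‖) (ρ ^ 2) := by
  rw [stretch]
  generalize ‖z₀ ^ 2 + 2 * κ * z₀ - κ‖ = N
  rw [mul_div_assoc', mul_max_of_nonneg _ _ hρ.le, div_mul_eq_mul_div,
    max_mul_of_nonneg _ _ hP.le, ← max_div_div_right (by positivity)]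
  congr 1 <;> field_simp

variable [IsUltrametricDist K]

theorem norm_add_kappa_eq {κ z₀ z : K} (hz : ‖z - z₀‖ < ‖z₀ + κ‖) : ‖z + κ‖ = ‖z₀ + κ‖ := by
  apply norm_eq_of_norm_sub_lt
  rwa [add_sub_add_right_eq_sub z z₀ κ]

/-- On a disk that avoids the pole, `stretch` is a Lipschitz constant. -/
theorem norm_qmap_sub_le {B : K} (hB : ‖B‖ = 1) {κ z₀ z w : K} {ρ : ℝ}
    (hz : ‖z - z₀‖ ≤ ρ) (hw : ‖w - z₀‖ ≤ ρ) (hz' : ‖z - z₀‖ < ‖z₀ + κ‖)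
    (hw' : ‖w - z₀‖ < ‖z₀ + κ‖) :
    ‖qmap B κ z - qmap B κ w‖ ≤ stretch κ z₀ ρ * ‖z - w‖ := by
  have hP : 0 < ‖z₀ + κ‖ := (norm_nonneg _).trans_lt hz'
  have hzk := norm_add_kappa_eq hz'
  have hwk := norm_add_kappa_eq hw'
  have hρ : 0 ≤ ρ := (norm_nonneg _).trans hz
  rw [norm_qmap_sub hB (norm_pos_iff.1 (hzk ▸ hP)) (norm_pos_iff.1 (hwk ▸ hP)), hzk, hwk,
    stretch, mul_comm (max _ _ / _), mul_div_assoc, sq ‖z₀ + κ‖]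
  gcongr
  have e : z * w + κ * (z + w) - κ = (z₀ ^ 2 + 2 * κ * z₀ - κ) +
      ((z₀ + κ) * ((z - z₀) + (w - z₀)) + (z - z₀) * (w - z₀)) := by ring
  rw [e]
  refine ultrametric_add_le (le_max_left _ _) (le_trans ?_ (le_max_right _ _))
  refine ultrametric_add_le ?_ ?_
  · rw [norm_mul]
    gcongr
    exact ultrametric_add_le hz hw
  · rw [norm_mul]
    gcongr

/-- The image of an open disk that avoids the pole contains a whole open disk: the smaller root of
a quadratic equation lies in the given disk. -/
theorem exists_qmap_eq_of_lt [IsAlgClosed K] {B : K} (hB : ‖B‖ = 1) {κ z₀ t : K} {ρ : ℝ}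
    (hρ : 0 < ρ) (hρP : ρ ≤ ‖z₀ + κ‖) (ht : ‖t - qmap B κ z₀‖ < ρ * stretch κ z₀ ρ) :
    ∃ z, ‖z - z₀‖ < ρ ∧ qmap B κ z = t := by
  have hP : 0 < ‖z₀ + κ‖ := hρ.trans_le hρP
  have hB0 : B ≠ 0 := norm_pos_iff.1 (by rw [hB]; exact one_pos)
  set s := (t - qmap B κ z₀) / B with hs
  set N := z₀ ^ 2 + 2 * κ * z₀ - κ with hN
  have hsn : ‖s‖ = ‖t - qmap B κ z₀‖ := by rw [hs, norm_div, hB, div_one]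
  clear_value s
  obtain ⟨x, y, hxy, hd, hle⟩ := exists_roots_norm_le (s - N / (z₀ + κ)) (-(s * (z₀ + κ)))
  have hxρ : ‖x‖ < ρ := by
    by_contra! hcon
    have hprod : ‖x‖ * ‖y‖ = ‖s‖ * ‖z₀ + κ‖ := by rw [← norm_mul, hd, norm_neg, norm_mul]
    have h1 : ‖s‖ * ‖z₀ + κ‖ < max (‖N‖ * ρ / ‖z₀ + κ‖) (ρ ^ 2) := by
      rw [hsn]
      refine (mul_lt_mul_of_pos_right ht hP).trans_le (mul_stretch hP hρ).le
    have h2 : ρ ^ 2 ≤ ‖x‖ * ‖y‖ := by nlinarith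
    rw [← hprod] at h1
    have h3 : ‖x‖ * ‖y‖ < ‖N‖ * ρ / ‖z₀ + κ‖ := (lt_max_iff.1 h1).resolve_right (not_lt.2 h2)
    have h4 : ‖s‖ < ‖N / (z₀ + κ)‖ := by
      rw [norm_div, lt_div_iff₀ hP, ← hprod]
      refine h3.trans_le ?_
      rw [div_le_iff₀ hP]
      gcongr
    have h5 : ‖N / (z₀ + κ)‖ ≤ ‖y‖ := by
      have : ‖x + y‖ = ‖N / (z₀ + κ)‖ := by
        rw [hxy, ← norm_neg, neg_sub, sub_eq_add_neg]
        exact norm_add_eq_of_lt (by rwa [norm_neg])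
      rw [← this]
      exact ultrametric_add_le hle le_rfl
    rw [norm_div] at h5
    have h6 : ρ * (‖N‖ / ‖z₀ + κ‖) ≤ ‖x‖ * ‖y‖ := by gcongr
    rw [mul_div_assoc', mul_comm ρ] at h6
    linarith
  refine ⟨z₀ + x, by simpa using hxρ, qmap_add_eq hB0 (norm_pos_iff.1 hP) ?_ (hs ▸ hxy) (hs ▸ hd)⟩
  rw [← norm_pos_iff, norm_add_kappa_eq (z₀ := z₀) (by simpa using hxρ.trans_le hρP)]
  exact hP

/-- The closed-disk counterpart of `exists_qmap_eq_of_lt`. -/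
theorem exists_qmap_eq_of_le [IsAlgClosed K] {B : K} (hB : ‖B‖ = 1) {κ z₀ t : K} {ρ : ℝ}
    (hρ : 0 < ρ) (hρP : ρ < ‖z₀ + κ‖) (ht : ‖t - qmap B κ z₀‖ ≤ ρ * stretch κ z₀ ρ) :
    ∃ z, ‖z - z₀‖ ≤ ρ ∧ qmap B κ z = t := by
  have hP : 0 < ‖z₀ + κ‖ := hρ.trans hρP
  have hB0 : B ≠ 0 := norm_pos_iff.1 (by rw [hB]; exact one_pos)
  set s := (t - qmap B κ z₀) / B with hs
  set N := z₀ ^ 2 + 2 * κ * z₀ - κ with hN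
  have hsn : ‖s‖ = ‖t - qmap B κ z₀‖ := by rw [hs, norm_div, hB, div_one]
  clear_value s
  obtain ⟨x, y, hxy, hd, hle⟩ := exists_roots_norm_le (s - N / (z₀ + κ)) (-(s * (z₀ + κ)))
  have hxρ : ‖x‖ ≤ ρ := by
    by_contra! hcon
    have hprod : ‖x‖ * ‖y‖ = ‖s‖ * ‖z₀ + κ‖ := by rw [← norm_mul, hd, norm_neg, norm_mul]
    have h1 : ‖s‖ * ‖z₀ + κ‖ ≤ max (‖N‖ * ρ / ‖z₀ + κ‖) (ρ ^ 2) := by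
      rw [hsn]
      refine (mul_le_mul_of_nonneg_right ht hP.le).trans (mul_stretch hP hρ).le
    have h2 : ρ ^ 2 < ‖x‖ * ‖y‖ := by nlinarith
    rw [← hprod] at h1
    have h3 : ‖x‖ * ‖y‖ ≤ ‖N‖ * ρ / ‖z₀ + κ‖ := (le_max_iff.1 h1).resolve_right (not_le.2 h2)
    have hNpos : 0 < ‖N‖ := by
      refine (norm_nonneg N).lt_of_ne fun h => ?_
      rw [← h, zero_mul, zero_div] at h3
      nlinarith
    have h4 : ‖s‖ < ‖N / (z₀ + κ)‖ := by
      rw [norm_div, lt_div_iff₀ hP, ← hprod]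
      refine h3.trans_lt ?_
      rw [div_lt_iff₀ hP]
      gcongr
    have h5 : ‖N / (z₀ + κ)‖ ≤ ‖y‖ := by
      have : ‖x + y‖ = ‖N / (z₀ + κ)‖ := by
        rw [hxy, ← norm_neg, neg_sub, sub_eq_add_neg]
        exact norm_add_eq_of_lt (by rwa [norm_neg])
      rw [← this]
      exact ultrametric_add_le hle le_rfl
    rw [norm_div] at h5
    have h7 : 0 < ‖N‖ / ‖z₀ + κ‖ := by positivity
    have h6 : ρ * (‖N‖ / ‖z₀ + κ‖) < ‖x‖ * ‖y‖ :=
      (mul_lt_mul_of_pos_right hcon h7).trans_le (by gcongr)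
    rw [mul_div_assoc', mul_comm ρ] at h6
    linarith
  refine ⟨z₀ + x, by simpa using hxρ, qmap_add_eq hB0 (norm_pos_iff.1 hP) ?_ (hs ▸ hxy) (hs ▸ hd)⟩
  rw [← norm_pos_iff, norm_add_kappa_eq (z₀ := z₀) (by simpa using hxρ.trans_lt hρP)]
  exact hP

end QuadraticMap

/-! ### The three regions of the dynamics, and disks along an orbit -/

section Model

variable {K : Type*} [NormedField K]

/-- The numerical constraints on `z ↦ B (z² - z) / (z + κ)`. With `p = ‖c‖`, the pole `-κ` has
absolute value `p²`, and the map acts as an expansion by `p⁻²` on `‖z‖ < p²`, isometrically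
from the residue disk of `1` onto that of `0`, and with degree two on the circle `‖z‖ = p`. -/
structure IsModel (c B κ : K) : Prop where
  c_ne : c ≠ 0
  c_lt : ‖c‖ < 1
  norm_B : ‖B‖ = 1
  norm_B_add : ‖B + 1‖ ≤ ‖c‖
  norm_κ : ‖κ‖ = ‖c‖ ^ 2

/-- The region in which the orbits take place: the expanding disk `‖z‖ < ‖c‖²`, the circle
`‖z‖ = ‖c‖` and the residue disk of `1`. -/
def Good (c z : K) : Prop := ‖z‖ < ‖c‖ ^ 2 ∨ ‖z‖ = ‖c‖ ∨ ‖z - 1‖ < 1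

theorem qmap_zero (B κ : K) : qmap B κ 0 = 0 := by simp [qmap]

theorem qmap_one (B κ : K) : qmap B κ 1 = 0 := by simp [qmap]

/-- Every small enough radius is the radius of the image of some disk around `z`. -/
theorem exists_mul_stretch_eq {κ z : K} (hP : 0 < ‖z + κ‖) {σ : ℝ} (hσ : 0 < σ)
    (hlt : σ < ‖z + κ‖ ∨ σ < ‖z ^ 2 + 2 * κ * z - κ‖ / ‖z + κ‖) :
    ∃ ρ, 0 < ρ ∧ ρ < ‖z + κ‖ ∧ ρ * stretch κ z ρ = σ := by
  suffices H : ∃ ρ, 0 < ρ ∧ ρ < ‖z + κ‖ ∧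
      max (‖z ^ 2 + 2 * κ * z - κ‖ * ρ / ‖z + κ‖) (ρ ^ 2) = σ * ‖z + κ‖ by
    obtain ⟨ρ, h0, h1, h2⟩ := H
    refine ⟨ρ, h0, h1, mul_right_cancel₀ hP.ne' ?_⟩
    rw [mul_stretch hP h0, h2]
  generalize ‖z ^ 2 + 2 * κ * z - κ‖ = N at *
  generalize ‖z + κ‖ = P at *
  have hs : 0 < σ * P := by positivity
  have hss := Real.sq_sqrt hs.le
  have hs0 := Real.sqrt_pos.2 hs
  rcases le_total (N * √(σ * P) / P) (σ * P) with hle | hle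
  · refine ⟨√(σ * P), hs0, ?_, by rw [hss, max_eq_right hle]⟩
    rcases hlt with hlt | hlt
    · rw [Real.sqrt_lt' hP]; nlinarith
    · rw [div_le_iff₀ hP] at hle
      rw [lt_div_iff₀ hP] at hlt
      nlinarith
  · rw [le_div_iff₀ hP] at hle
    have hN : 0 < N := by
      by_contra! hN
      nlinarith [mul_pos hs hP]
    have hρ : σ * P ^ 2 / N ≤ √(σ * P) := by
      rw [div_le_iff₀ hN]; nlinarith
    refine ⟨σ * P ^ 2 / N, by positivity, ?_, ?_⟩
    · rcases hlt with hlt | hlt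
      · refine hρ.trans_lt ?_
        rw [Real.sqrt_lt' hP]; nlinarith
      · rw [lt_div_iff₀ hP] at hlt
        rw [div_lt_iff₀ hN]; nlinarith
    · rw [max_eq_left]
      · field_simp
      · have : (σ * P ^ 2 / N) ^ 2 ≤ √(σ * P) ^ 2 := by gcongr
        rw [hss] at this
        refine this.trans (le_of_eq ?_)
        field_simp

theorem IsModel.pos {c B κ : K} (h : IsModel c B κ) : 0 < ‖c‖ := norm_pos_iff.2 h.c_ne

theorem IsModel.sq_lt {c B κ : K} (h : IsModel c B κ) : ‖c‖ ^ 2 < ‖c‖ := by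
  have := h.pos; have := h.c_lt; nlinarith

variable [IsUltrametricDist K]

theorem norm_eq_one_of_lt {z : K} (hz : ‖z - 1‖ < 1) : ‖z‖ = 1 := by
  rw [← norm_one (α := K)] at hz
  rw [norm_eq_of_norm_sub_lt hz, norm_one]

namespace IsModel

variable {c B κ : K} (h : IsModel c B κ)
include h

theorem norm_add_small {z : K} (hz : ‖z‖ < ‖c‖ ^ 2) : ‖z + κ‖ = ‖c‖ ^ 2 := by
  rw [add_comm, norm_add_eq_of_lt (by rwa [h.norm_κ]), h.norm_κ]

theorem norm_add_mid {z : K} (hz : ‖z‖ = ‖c‖) : ‖z + κ‖ = ‖c‖ := by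
  rw [norm_add_eq_of_lt (by rw [h.norm_κ, hz]; exact h.sq_lt), hz]

theorem norm_add_one {z : K} (hz : ‖z - 1‖ < 1) : ‖z + κ‖ = 1 := by
  have := norm_eq_one_of_lt hz
  rw [norm_add_eq_of_lt (by rw [h.norm_κ, this]; exact h.sq_lt.trans h.c_lt), this]

theorem le_norm_add {z : K} (hz : Good c z) : ‖c‖ ^ 2 ≤ ‖z + κ‖ := by
  rcases hz with hz | hz | hz
  · rw [h.norm_add_small hz]
  · rw [h.norm_add_mid hz]; exact h.sq_lt.le
  · rw [h.norm_add_one hz]; exact (h.sq_lt.trans h.c_lt).le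

theorem add_ne_zero {z : K} (hz : Good c z) : z + κ ≠ 0 :=
  norm_pos_iff.1 ((pow_pos h.pos 2).trans_le (h.le_norm_add hz))

theorem norm_le_one {z : K} (hz : Good c z) : ‖z‖ ≤ 1 := by
  rcases hz with hz | hz | hz
  · exact hz.le.trans (h.sq_lt.trans h.c_lt).le
  · rw [hz]; exact h.c_lt.le
  · exact (norm_eq_one_of_lt hz).le

theorem norm_bilin_small {z w : K} (hz : ‖z‖ < ‖c‖ ^ 2) (hw : ‖w‖ < ‖c‖ ^ 2) :
    ‖z * w + κ * (z + w) - κ‖ = ‖c‖ ^ 2 := by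
  have hp := pow_pos h.pos 2
  have h1 : ‖c‖ ^ 2 < 1 := h.sq_lt.trans h.c_lt
  rw [sub_eq_add_neg, add_comm, norm_add_eq_of_lt] <;> rw [norm_neg, h.norm_κ]
  refine ultrametric_add_lt ?_ ?_
  · rw [norm_mul]
    nlinarith [norm_nonneg z, norm_nonneg w]
  · rw [norm_mul, h.norm_κ]
    have := ultrametric_add_lt hz hw
    nlinarith

theorem norm_bilin_one {z w : K} (hz : ‖z - 1‖ < 1) (hw : ‖w - 1‖ < 1) :
    ‖z * w + κ * (z + w) - κ‖ = 1 := by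
  have hz1 := norm_eq_one_of_lt hz
  have hw1 := norm_eq_one_of_lt hw
  have h1 : ‖c‖ ^ 2 < 1 := h.sq_lt.trans h.c_lt
  have : ‖z * w‖ = 1 := by rw [norm_mul, hz1, hw1, one_mul]
  rw [add_sub_assoc, norm_add_eq_of_lt] <;> rw [this]
  refine lt_of_le_of_lt ?_ h1
  refine ultrametric_sub_le ?_ h.norm_κ.le
  rw [norm_mul, h.norm_κ]
  exact mul_le_of_le_one_right (by positivity) (ultrametric_add_le hz1.le hw1.le)

theorem norm_bilin_mid {z w : K} (hz : ‖z‖ = ‖c‖) (hw : ‖w‖ = ‖c‖) :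
    ‖z * w + κ * (z + w) - κ‖ ≤ ‖c‖ ^ 2 := by
  refine ultrametric_sub_le (ultrametric_add_le ?_ ?_) h.norm_κ.le
  · rw [norm_mul, hz, hw, sq]
  · rw [norm_mul, h.norm_κ]
    exact mul_le_of_le_one_right (by positivity)
      ((ultrametric_add_le hz.le hw.le).trans h.c_lt.le)

theorem norm_sub_small {z w : K} (hz : ‖z‖ < ‖c‖ ^ 2) (hw : ‖w‖ < ‖c‖ ^ 2) :
    ‖qmap B κ z - qmap B κ w‖ = ‖z - w‖ / ‖c‖ ^ 2 := by
  have hp := pow_pos h.pos 2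
  rw [norm_qmap_sub h.norm_B (h.add_ne_zero (.inl hz)) (h.add_ne_zero (.inl hw)),
    h.norm_add_small hz, h.norm_add_small hw, h.norm_bilin_small hz hw]
  field_simp

theorem norm_sub_one {z w : K} (hz : ‖z - 1‖ < 1) (hw : ‖w - 1‖ < 1) :
    ‖qmap B κ z - qmap B κ w‖ = ‖z - w‖ := by
  rw [norm_qmap_sub h.norm_B (h.add_ne_zero (.inr (.inr hz))) (h.add_ne_zero (.inr (.inr hw))),
    h.norm_add_one hz, h.norm_add_one hw, h.norm_bilin_one hz hw]
  simp

theorem norm_sub_mid_le {z w : K} (hz : ‖z‖ = ‖c‖) (hw : ‖w‖ = ‖c‖) :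
    ‖qmap B κ z - qmap B κ w‖ ≤ ‖z - w‖ := by
  rw [norm_qmap_sub h.norm_B (h.add_ne_zero (.inr (.inl hz))) (h.add_ne_zero (.inr (.inl hw))),
    h.norm_add_mid hz, h.norm_add_mid hw, ← sq]
  have hp := pow_pos h.pos 2
  rw [div_le_iff₀ hp]
  gcongr
  exact h.norm_bilin_mid hz hw

theorem norm_small {z : K} (hz : ‖z‖ < ‖c‖ ^ 2) : ‖qmap B κ z‖ = ‖z‖ / ‖c‖ ^ 2 := by
  simpa [qmap_zero] using h.norm_sub_small hz (w := 0) (by simpa using pow_pos h.pos 2)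

theorem norm_near_one {z : K} (hz : ‖z - 1‖ < 1) : ‖qmap B κ z‖ = ‖z - 1‖ := by
  simpa [qmap_one] using h.norm_sub_one hz (w := 1) (by simp)

theorem stretch_small {z : K} (hz : ‖z‖ < ‖c‖ ^ 2) {ρ : ℝ} (hρ : ρ ≤ 1) :
    stretch κ z ρ = 1 / ‖c‖ ^ 2 := by
  have hp := pow_pos h.pos 2
  have e : z ^ 2 + 2 * κ * z - κ = z * z + κ * (z + z) - κ := by ring
  rw [stretch, e, h.norm_bilin_small hz hz, h.norm_add_small hz,
    max_eq_left (mul_le_of_le_one_right hp.le hρ)]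
  field_simp

theorem stretch_one {z : K} (hz : ‖z - 1‖ < 1) {ρ : ℝ} (hρ : ρ ≤ 1) :
    stretch κ z ρ = 1 := by
  have e : z ^ 2 + 2 * κ * z - κ = z * z + κ * (z + z) - κ := by ring
  rw [stretch, e, h.norm_bilin_one hz hz, h.norm_add_one hz, one_mul, max_eq_left hρ]
  simp

end IsModel

/-- Pulling a disk back along an orbit. Some closed disk around `x` is mapped by the `n`-th iterate
onto the closed disk of radius `σ` around the image of `x`, residue disks going into residue
disks. -/
theorem exists_pullback [IsAlgClosed K] {c B κ : K} (h : IsModel c B κ) {σ : ℝ} (hσ : 0 < σ)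
    (hσc : σ < ‖c‖) (n : ℕ) (x : K) (hx : ∀ i ≤ n, Good c ((qmap B κ)^[i] x)) :
    ∃ ρ, 0 < ρ ∧ ρ < ‖c‖ ∧
      (∀ z, ‖z - x‖ ≤ ρ → (∀ i < n, (qmap B κ)^[i] z + κ ≠ 0) ∧
        ∀ i ≤ n, ‖(qmap B κ)^[i] z‖ ≤ 1) ∧
      (∀ z w, ‖z - x‖ ≤ ρ → ‖w - x‖ ≤ ρ → ‖z - w‖ < ρ →
        ‖(qmap B κ)^[n] z - (qmap B κ)^[n] w‖ < σ) ∧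
      ∀ t, ‖t - (qmap B κ)^[n] x‖ ≤ σ → ∃ z, ‖z - x‖ ≤ ρ ∧ (qmap B κ)^[n] z = t := by
  have hle1 : ∀ {y : K} {ρ : ℝ}, Good c y → ρ < ‖c‖ → ∀ z, ‖z - y‖ ≤ ρ → ‖z‖ ≤ 1 := by
    intro y ρ hy hρ z hz
    have := ultrametric_add_le (hz.trans (hρ.trans h.c_lt).le) (h.norm_le_one hy)
    rwa [sub_add_cancel] at this
  induction n generalizing x with
  | zero =>
    refine ⟨σ, hσ, hσc, fun z hz => ⟨by simp, fun i hi => ?_⟩, by simp, by simp⟩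
    obtain rfl : i = 0 := by omega
    exact hle1 (hx 0 le_rfl) hσc z hz
  | succ n ih =>
    obtain ⟨ρ₁, h0, h1, ha, hb, hc⟩ := ih (qmap B κ x) fun i hi => by
      simpa using hx (i + 1) (by omega)
    have hgx : Good c x := hx 0 (by omega)
    have hPx : 0 < ‖x + κ‖ := norm_pos_iff.2 (h.add_ne_zero hgx)
    have e : x ^ 2 + 2 * κ * x - κ = x * x + κ * (x + x) - κ := by ring
    obtain ⟨ρ, hρ0, hρP, hρ⟩ := exists_mul_stretch_eq hPx h0 (by
      rcases hgx with hg | hg | hg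
      · right
        rw [e, h.norm_bilin_small hg hg, h.norm_add_small hg, div_self (pow_pos h.pos 2).ne']
        exact h1.trans h.c_lt
      · left; rwa [h.norm_add_mid hg]
      · left; rw [h.norm_add_one hg]; exact h1.trans h.c_lt)
    have hρc : ρ < ‖c‖ := by
      rcases hgx with hg | hg | hg
      · rw [h.norm_add_small hg] at hρP; exact hρP.trans h.sq_lt
      · rwa [h.norm_add_mid hg] at hρP
      · rw [h.norm_add_one hg] at hρP
        rw [h.stretch_one hg hρP.le, mul_one] at hρ
        rwa [hρ]
    have hlip : ∀ z w, ‖z - x‖ ≤ ρ → ‖w - x‖ ≤ ρ →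
        ‖qmap B κ z - qmap B κ w‖ ≤ stretch κ x ρ * ‖z - w‖ := fun z w hz hw =>
      norm_qmap_sub_le h.norm_B hz hw (hz.trans_lt hρP) (hw.trans_lt hρP)
    have hspos := stretch_pos (h.add_ne_zero hgx) hρ0
    have himg : ∀ z, ‖z - x‖ ≤ ρ → ‖qmap B κ z - qmap B κ x‖ ≤ ρ₁ := by
      intro z hz
      refine (hlip z x hz (by simpa using hρ0.le)).trans ?_
      rw [← hρ, mul_comm]
      gcongr
    refine ⟨ρ, hρ0, hρc, fun z hz => ⟨fun i hi => ?_, fun i hi => ?_⟩, ?_, ?_⟩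
    · rcases i with _ | i
      · rw [Function.iterate_zero, _root_.id, ← norm_pos_iff,
          norm_add_kappa_eq (hz.trans_lt hρP)]
        exact hPx
      · exact (ha _ (himg z hz)).1 i (by omega)
    · rcases i with _ | i
      · exact hle1 hgx hρc z hz
      · exact (ha _ (himg z hz)).2 i (by omega)
    · intro z w hz hw hzw
      refine hb _ _ (himg z hz) (himg w hw) ((hlip z w hz hw).trans_lt ?_)
      rw [← hρ, mul_comm]
      gcongr
    · intro t ht
      obtain ⟨y, hy, hyt⟩ := hc t ht
      obtain ⟨z, hz, hzy⟩ := exists_qmap_eq_of_le h.norm_B hρ0 hρP (by rw [hρ]; exact hy)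
      exact ⟨z, hz, by rw [Function.iterate_succ_apply, hzy, hyt]⟩

/-- The radii of the successive images of the disk of radius `r` around `x`. -/
def orbitRad (B κ x : K) (r : ℝ) : ℕ → ℝ
  | 0 => r
  | n + 1 => orbitRad B κ x r n * stretch κ ((qmap B κ)^[n] x) (orbitRad B κ x r n)

theorem orbitRad_pos {c B κ : K} (h : IsModel c B κ) {x : K} {r : ℝ} (hr : 0 < r) (n : ℕ)
    (hx : ∀ i < n, Good c ((qmap B κ)^[i] x)) : 0 < orbitRad B κ x r n := by
  induction n with
  | zero => exact hr
  | succ n ih =>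
    have := ih fun i hi => hx i (by omega)
    exact mul_pos this (stretch_pos (h.add_ne_zero (hx n (by omega))) this)

/-- As long as the orbit of `x` stays in the good region and the radii stay at most `‖c‖²`, so that
the disks avoid the pole, the images of a disk are disks of radii `orbitRad`, and the iterates are
Lipschitz with the ratio of the radii as a constant. -/
theorem image_iterate_ball [IsAlgClosed K] {c B κ : K} (h : IsModel c B κ) {x : K} {r : ℝ}
    (hr : 0 < r) (n : ℕ) (hx : ∀ i < n, Good c ((qmap B κ)^[i] x))
    (hrad : ∀ i < n, orbitRad B κ x r i ≤ ‖c‖ ^ 2) :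
    (qmap B κ)^[n] '' {z | ‖z - x‖ < r} =
        {z | ‖z - (qmap B κ)^[n] x‖ < orbitRad B κ x r n} ∧
      ∀ z w, ‖z - x‖ < r → ‖w - x‖ < r →
        ‖(qmap B κ)^[n] z - (qmap B κ)^[n] w‖ * r ≤ orbitRad B κ x r n * ‖z - w‖ := by
  induction n with
  | zero => exact ⟨by simp [orbitRad], fun z w _ _ => by simp [orbitRad, mul_comm]⟩
  | succ n ih =>
    obtain ⟨ih1, ih2⟩ := ih (fun i hi => hx i (by omega)) (fun i hi => hrad i (by omega))
    have hg := hx n (by omega)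
    have hpos := orbitRad_pos h hr n fun i hi => hx i (by omega)
    have hP := (hrad n (by omega)).trans (h.le_norm_add hg)
    have hs := stretch_pos (h.add_ne_zero hg) hpos
    set ρ := orbitRad B κ x r n with hρ
    set y := (qmap B κ)^[n] x with hy
    have hlip : ∀ z w, ‖z - y‖ < ρ → ‖w - y‖ < ρ →
        ‖qmap B κ z - qmap B κ w‖ ≤ stretch κ y ρ * ‖z - w‖ := fun z w hz hw =>
      norm_qmap_sub_le h.norm_B hz.le hw.le (hz.trans_le hP) (hw.trans_le hP)
    have e1 : orbitRad B κ x r (n + 1) = ρ * stretch κ y ρ := rfl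
    have hmem : ∀ z, ‖z - x‖ < r → ‖(qmap B κ)^[n] z - y‖ < ρ := fun z hz => by
      have : (qmap B κ)^[n] z ∈ (qmap B κ)^[n] '' {z | ‖z - x‖ < r} := ⟨z, hz, rfl⟩
      rw [ih1] at this
      exact this
    rw [Function.iterate_succ', Set.image_comp, ih1, e1]
    refine ⟨Set.ext fun t => ⟨?_, fun ht => ?_⟩, fun z w hz hw => ?_⟩
    · rintro ⟨z, hz, rfl⟩
      refine (hlip z y hz (by simpa using hpos)).trans_lt ?_
      rw [mul_comm]
      exact mul_lt_mul_of_pos_right hz hs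
    · exact exists_qmap_eq_of_lt h.norm_B hpos hP ht
    · calc ‖qmap B κ ((qmap B κ)^[n] z) - qmap B κ ((qmap B κ)^[n] w)‖ * r
          ≤ stretch κ y ρ * ‖(qmap B κ)^[n] z - (qmap B κ)^[n] w‖ * r := by
            gcongr
            exact hlip _ _ (hmem z hz) (hmem w hw)
        _ = stretch κ y ρ * (‖(qmap B κ)^[n] z - (qmap B κ)^[n] w‖ * r) := by ring
        _ ≤ stretch κ y ρ * (ρ * ‖z - w‖) := mul_le_mul_of_nonneg_left (ih2 z w hz hw) hs.le
        _ = ρ * stretch κ y ρ * ‖z - w‖ := by ring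

theorem norm_iterate_sub_lt [IsAlgClosed K] {c B κ : K} (h : IsModel c B κ) {x z : K} {r : ℝ}
    (hr : 0 < r) (n : ℕ) (hx : ∀ i < n, Good c ((qmap B κ)^[i] x))
    (hrad : ∀ i < n, orbitRad B κ x r i ≤ ‖c‖ ^ 2) (hz : ‖z - x‖ < r) :
    ‖(qmap B κ)^[n] z - (qmap B κ)^[n] x‖ < orbitRad B κ x r n := by
  have : (qmap B κ)^[n] z ∈ (qmap B κ)^[n] '' {z | ‖z - x‖ < r} := ⟨z, hz, rfl⟩
  rw [(image_iterate_ball h hr n hx hrad).1] at this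
  exact this

end Model

/-! ### The chordal distance on the unit disk -/

section Chordal

variable {K : Type*} [NormedField K]

theorem chordalDist_coe (z w : K) :
    chordalDist (z : OnePoint K) w = ‖z - w‖ / (max 1 ‖z‖ * max 1 ‖w‖) := rfl

theorem chordalDist_coe_infty (z : K) :
    chordalDist (z : OnePoint K) OnePoint.infty = 1 / max 1 ‖z‖ := rfl

theorem chordalDist_coe_of_le {z w : K} (hz : ‖z‖ ≤ 1) (hw : ‖w‖ ≤ 1) :
    chordalDist (z : OnePoint K) w = ‖z - w‖ := by
  rw [chordalDist_coe, max_eq_left hz, max_eq_left hw, one_mul, div_one]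

theorem chordalDist_self (z : K) : chordalDist (z : OnePoint K) z = 0 := by
  simp [chordalDist_coe]

variable [IsUltrametricDist K]

theorem exists_coe_of_chordalDist_lt {z : K} (hz : ‖z‖ ≤ 1) {y : OnePoint K} {δ : ℝ}
    (hδ : δ ≤ 1) (hy : chordalDist (z : OnePoint K) y < δ) :
    ∃ w : K, y = w ∧ ‖w‖ ≤ 1 ∧ ‖z - w‖ < δ := by
  induction y using OnePoint.rec with
  | infty =>
    rw [chordalDist_coe_infty, max_eq_left hz, div_one] at hy
    linarith
  | coe w =>
    have hw : ‖w‖ ≤ 1 := by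
      by_contra! hw
      have : ‖z - w‖ = ‖w‖ := by
        rw [norm_sub_rev, sub_eq_add_neg]
        exact norm_add_eq_of_lt (by rw [norm_neg]; exact hz.trans_lt hw)
      rw [chordalDist_coe, max_eq_left hz, max_eq_right hw.le, one_mul, this,
        div_self (by linarith)] at hy
      linarith
    rw [chordalDist_coe_of_le hz hw] at hy
    exact ⟨w, rfl, hw, hy⟩

end Chordal

/-! ### Confining an analytic component -/

section Affinoid

variable {K : Type*} [NormedField K]

theorem coe_mem_openDisk {a z : K} {r : ℝ} : (z : OnePoint K) ∈ openDisk a r ↔ ‖z - a‖ < r := by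
  simp [openDisk]

theorem coe_mem_closedDisk {a z : K} {r : ℝ} :
    (z : OnePoint K) ∈ closedDisk a r ↔ ‖z - a‖ ≤ r := by
  simp [closedDisk]

theorem isConnectedAffinoid_openDisk {a : K} {r : ℝ} (hr : 0 < r) :
    IsConnectedAffinoid (openDisk a r) := by
  refine ⟨⟨a, coe_mem_openDisk.2 (by simpa using hr)⟩, {(openDisk a r)ᶜ}, Set.finite_singleton _,
    ?_, by simp⟩
  rintro D rfl
  exact ⟨a, r, hr, .inr (.inr (.inl rfl))⟩

variable [IsUltrametricDist K]

/-- Two points `x`, `y` of which the second is at distance at least `r` from the first cannot be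
separated by a disk from two points `j`, `k` at distance at least `r` from each other of which `j`
lies in the closed disk of radius `r` around `x`. -/
theorem IsProjectiveDisk.mem_or_mem {D : Set (OnePoint K)} (hD : IsProjectiveDisk D) {x j k : K}
    {r : ℝ} {y : OnePoint K} (hy : y ∉ openDisk x r) (hj : ‖j - x‖ ≤ r)
    (hjk : r ≤ ‖j - k‖) (hjD : (j : OnePoint K) ∈ D) (hkD : (k : OnePoint K) ∈ D) :
    (x : OnePoint K) ∈ D ∨ y ∈ D := by
  have hxj : ‖x - j‖ ≤ r := by rwa [norm_sub_rev]
  obtain ⟨a, ρ, -, rfl | rfl | rfl | rfl⟩ := hD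
  · left
    rw [coe_mem_openDisk] at *
    have h1 : ‖j - k‖ < ρ := by simpa using ultrametric_sub_lt hjD hkD
    simpa using ultrametric_add_lt (hxj.trans_lt (hjk.trans_lt h1)) hjD
  · left
    rw [coe_mem_closedDisk] at *
    have h1 : ‖j - k‖ ≤ ρ := by simpa using ultrametric_sub_le hjD hkD
    simpa using ultrametric_add_le (hxj.trans (hjk.trans h1)) hjD
  · by_contra! hcon
    simp only [Set.mem_compl_iff, not_not] at hcon
    obtain ⟨hx, z, hz, rfl⟩ := hcon
    refine hjD ?_
    rw [coe_mem_openDisk] at *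
    rw [not_lt] at hy
    have h1 : ‖z - x‖ < ρ := by simpa using ultrametric_sub_lt hz hx
    simpa using ultrametric_add_lt (hj.trans_lt (hy.trans_lt h1)) hx
  · by_contra! hcon
    simp only [Set.mem_compl_iff, not_not] at hcon
    obtain ⟨hx, z, hz, rfl⟩ := hcon
    refine hjD ?_
    rw [coe_mem_openDisk] at hy
    rw [coe_mem_closedDisk] at *
    rw [not_lt] at hy
    have h1 : ‖z - x‖ ≤ ρ := by simpa using ultrametric_sub_le hz hx
    simpa using ultrametric_add_le (hj.trans (hy.trans h1)) hx

/-- If infinitely many residue classes of the closed disk of radius `r` around `x` contain points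
outside `X`, then the component of `X` at `x` lies in the open disk of radius `r`: the complement
of an affinoid has only finitely many holes. -/
theorem analyticComponent_subset_openDisk {X : Set (OnePoint K)} {x : K} {r : ℝ} (e : ℕ → K)
    (he : ∀ i, ‖e i - x‖ ≤ r) (hsep : ∀ i j, i < j → r ≤ ‖e i - e j‖)
    (hX : ∀ i, (e i : OnePoint K) ∉ X) : analyticComponent X x ⊆ openDisk x r := by
  rintro y ⟨W, ⟨⟨-, S, hS, hSd, hWS⟩, hxW, hWX⟩, hyW⟩
  by_contra hy
  have hmem : ∀ i, ∃ D ∈ S, (e i : OnePoint K) ∈ D := fun i => by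
    have : (e i : OnePoint K) ∈ Wᶜ := fun hi => hX i (hWX hi)
    rwa [hWS] at this
  choose D hDS hD using hmem
  have : Finite S := hS
  obtain ⟨i, j, hij, hDij⟩ := Finite.exists_ne_map_eq_of_infinite fun i => (⟨D i, hDS i⟩ : S)
  have hDij : D i = D j := congrArg Subtype.val hDij
  have key : ∀ i j, i < j → D i = D j → False := fun i j hij hDij => by
    have hout : ∀ z ∈ W, z ∉ D i := fun z hz hzD => by
      have : z ∈ Wᶜ := hWS ▸ ⟨D i, hDS i, hzD⟩
      exact this hz
    rcases (hSd _ (hDS i)).mem_or_mem hy (he i) (hsep i j hij) (hD i) (hDij ▸ hD j)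
      with hmem | hmem
    · exact hout _ hxW hmem
    · exact hout _ hyW hmem
  rcases hij.lt_or_gt with hlt | hlt
  · exact key i j hlt hDij
  · exact key j i hlt hDij.symm

end Affinoid

/-! ### Points outside the Fatou set, and a criterion for wandering components -/

section Julia

variable {K : Type*} [NontriviallyNormedField K] {c B κ : K} {R : OnePoint K → OnePoint K}

theorem iterate_coe (hR : ∀ z : K, z + κ ≠ 0 → R z = (qmap B κ z : K)) {n : ℕ} {z : K}
    (hz : ∀ i < n, (qmap B κ)^[i] z + κ ≠ 0) :
    R^[n] (z : OnePoint K) = ((qmap B κ)^[n] z : K) := by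
  induction n with
  | zero => rfl
  | succ n ih =>
    rw [Function.iterate_succ_apply', ih fun i hi => hz i (by omega), hR _ (hz n (by omega)),
      Function.iterate_succ_apply']

variable [IsUltrametricDist K]

/-- The repelling fixed point `0` is a point of the Julia set. -/
theorem not_equicontinuousIteratesAt_zero (h : IsModel c B κ)
    (hR : ∀ z : K, z + κ ≠ 0 → R z = (qmap B κ z : K)) :
    ¬ EquicontinuousIteratesAt R ((0 : K) : OnePoint K) := by
  intro hE
  obtain ⟨δ, hδ, hE⟩ := hE ‖c‖ h.pos
  have hpos := h.pos
  have hlt := h.c_lt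
  obtain ⟨k, hk⟩ := exists_pow_lt_of_lt_one hδ hlt
  have hck : ∀ j ≤ k, ∀ i ≤ j, (qmap B κ)^[i] 0 = 0 := fun _ _ i _ =>
    Function.iterate_fixed (qmap_zero B κ) i
  have key : ∀ j ≤ k, ‖(qmap B κ)^[j] (c ^ (2 * k + 1))‖ = ‖c‖ ^ (2 * (k - j) + 1) := by
    intro j hj
    induction j with
    | zero => simp
    | succ j ih =>
      have := ih (by omega)
      have e : 2 * (k - j) + 1 = 2 * (k - (j + 1)) + 1 + 2 := by omega
      rw [Function.iterate_succ_apply', h.norm_small, this, e, pow_add]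
      · field_simp
      · rw [this]
        exact pow_lt_pow_right_of_lt_one₀ hpos hlt (by omega)
  have hz : ∀ i < k, (qmap B κ)^[i] (c ^ (2 * k + 1)) + κ ≠ 0 := fun i hi =>
    h.add_ne_zero (.inl (by
      rw [key i hi.le]
      exact pow_lt_pow_right_of_lt_one₀ hpos hlt (by omega)))
  have h0 : ∀ i < k, (qmap B κ)^[i] 0 + κ ≠ 0 := fun i hi => by
    rw [hck k le_rfl i hi.le]
    exact h.add_ne_zero (.inl (by simpa using pow_pos hpos 2))
  have hle : ‖c ^ (2 * k + 1)‖ ≤ 1 := by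
    rw [norm_pow]; exact pow_le_one₀ hpos.le hlt.le
  have := hE ((c ^ (2 * k + 1) : K) : OnePoint K) (by
    rw [chordalDist_coe_of_le (by simp) hle, zero_sub, norm_neg, norm_pow]
    exact (pow_le_pow_of_le_one hpos.le hlt.le (by omega)).trans_lt hk) k
  rw [iterate_coe hR hz, iterate_coe hR h0, hck k le_rfl k le_rfl,
    chordalDist_coe_of_le (by simp) (by
      rw [key k le_rfl]; exact pow_le_one₀ hpos.le hlt.le), zero_sub, norm_neg,
    key k le_rfl] at this
  simp at this

variable [IsAlgClosed K]

/-- As the map is open, equicontinuity of the iterates passes from a point to its image. -/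
theorem EquicontinuousIteratesAt.qmap (h : IsModel c B κ)
    (hR : ∀ z : K, z + κ ≠ 0 → R z = (qmap B κ z : K)) {z : K} (hzκ : z + κ ≠ 0) (hz : ‖z‖ ≤ 1)
    (hfz : ‖qmap B κ z‖ ≤ 1) (hE : EquicontinuousIteratesAt R (z : OnePoint K)) :
    EquicontinuousIteratesAt R (qmap B κ z : K) := by
  intro ε hε
  obtain ⟨δ, hδ, hE⟩ := hE ε hε
  have hP : 0 < ‖z + κ‖ := norm_pos_iff.2 hzκ
  obtain ⟨ρ, hρ0, hρ⟩ : ∃ ρ, 0 < ρ ∧ ρ ≤ min δ (min 1 ‖z + κ‖) :=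
    ⟨_, by positivity, le_rfl⟩
  rw [le_min_iff, le_min_iff] at hρ
  have hs := stretch_pos hzκ hρ0
  refine ⟨min (ρ * stretch κ z ρ) 1, by positivity, fun y hy n => ?_⟩
  obtain ⟨t, rfl, -, ht⟩ := exists_coe_of_chordalDist_lt hfz (min_le_right _ _) hy
  obtain ⟨w, hw, rfl⟩ := exists_qmap_eq_of_lt h.norm_B hρ0 hρ.2.2
    (t := t) (by rw [norm_sub_rev]; exact ht.trans_le (min_le_left _ _))
  have hwκ : w + κ ≠ 0 := by
    rw [← norm_pos_iff, norm_add_kappa_eq (hw.trans_le hρ.2.2)]; exact hP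
  have hw1 : ‖w‖ ≤ 1 := by
    simpa using ultrametric_add_le (hw.le.trans hρ.2.1) hz
  have := hE w (by
    rw [chordalDist_coe_of_le hz hw1, norm_sub_rev]
    exact hw.trans_le hρ.1) (n + 1)
  rwa [Function.iterate_succ_apply, Function.iterate_succ_apply, hR z hzκ, hR w hwκ] at this

theorem EquicontinuousIteratesAt.iterate_qmap (h : IsModel c B κ)
    (hR : ∀ z : K, z + κ ≠ 0 → R z = (_root_.qmap B κ z : K)) {n : ℕ} {z : K}
    (hzκ : ∀ i < n, (_root_.qmap B κ)^[i] z + κ ≠ 0)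
    (hz : ∀ i ≤ n, ‖(_root_.qmap B κ)^[i] z‖ ≤ 1)
    (hE : EquicontinuousIteratesAt R (z : OnePoint K)) :
    EquicontinuousIteratesAt R ((_root_.qmap B κ)^[n] z : K) := by
  induction n with
  | zero => exact hE
  | succ n ih =>
    have h1 := hz (n + 1) le_rfl
    rw [Function.iterate_succ_apply'] at h1 ⊢
    exact (ih (fun i hi => hzκ i (by omega)) fun i hi => hz i (by omega)).qmap h hR
      (hzκ n (by omega)) (hz n (by omega)) h1

/-- The circle `‖z‖ = ‖c‖` is mapped onto a neighbourhood of `1`: as `‖B + 1‖` is small, the sum of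
the two preimages is small, and so they have equal absolute values. -/
theorem exists_qmap_eq_of_norm_one (h : IsModel c B κ) {y : K} (hy : ‖y - 1‖ ≤ ‖c‖) :
    ∃ z, ‖z‖ = ‖c‖ ∧ qmap B κ z = y := by
  have hpos := h.pos
  have hB : B ≠ 0 := norm_pos_iff.1 (by rw [h.norm_B]; exact one_pos)
  have hy1 : ‖y‖ = 1 := norm_eq_one_of_lt (hy.trans_lt h.c_lt)
  obtain ⟨z, w, hs, hp, hle⟩ := exists_roots_norm_le (1 + y / B) (-(y * κ / B))
  have hsn : ‖z + w‖ ≤ ‖c‖ := by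
    have e : 1 + y / B = ((B + 1) + (y - 1)) / B := by field_simp; ring
    rw [hs, e, norm_div, h.norm_B, div_one]
    exact ultrametric_add_le h.norm_B_add hy
  have hpn : ‖z‖ * ‖w‖ = ‖c‖ ^ 2 := by
    rw [← norm_mul, hp, norm_neg, norm_div, norm_mul, hy1, h.norm_κ, h.norm_B]
    simp
  have hzn : ‖z‖ = ‖c‖ := by
    rcases hle.lt_or_eq with hlt | heq
    · have : ‖z + w‖ = ‖w‖ := by rw [add_comm]; exact norm_add_eq_of_lt hlt
      rw [this] at hsn
      nlinarith [norm_nonneg z]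
    · rw [← heq] at hpn
      nlinarith [norm_nonneg z]
  refine ⟨z, hzn, ?_⟩
  have hzκ := h.add_ne_zero (.inr (.inl hzn))
  have hw : w = 1 + y / B - z := by rw [← hs]; ring
  rw [hw] at hp
  rw [_root_.qmap, div_eq_iff hzκ]
  field_simp at hp
  linear_combination -hp

/-- Each point of the circle `‖z‖ = ‖c‖` is the image under the second iterate of a point of the
circle. -/
theorem exists_preimage_on_circle (h : IsModel c B κ) {t : K} (ht : ‖t‖ = ‖c‖) :
    ∃ z, ‖z‖ = ‖c‖ ∧ ‖qmap B κ z - 1‖ < 1 ∧ qmap B κ (qmap B κ z) = t := by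
  have h1 : ‖(1 : K) - 1‖ < 1 := by simp
  obtain ⟨y, hy, hyt⟩ := exists_qmap_eq_of_lt h.norm_B one_pos (h.norm_add_one h1).ge (t := t)
    (by rw [h.stretch_one h1 le_rfl, qmap_one, sub_zero, ht, one_mul]; exact h.c_lt)
  have hyc : ‖y - 1‖ = ‖c‖ := by rw [← h.norm_near_one hy, hyt, ht]
  obtain ⟨z, hz, hzy⟩ := exists_qmap_eq_of_norm_one h hyc.le
  exact ⟨z, hz, by rwa [hzy], by rw [hzy, hyt]⟩

/-- Infinitely many residue classes of the circle `‖z‖ = ‖c‖` contain points of the Julia set,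
namely iterated preimages of `0`: a point `e 0` that the second iterate maps to `0`, and preimages
`e (i + 1)` of `e i` under the second iterate. If the classes of two of them were equal, then so
would be their images under the second iterate, and in the end `0` would lie in the class of a point
of the circle. -/
theorem exists_julia_points_on_circle (h : IsModel c B κ)
    (hR : ∀ z : K, z + κ ≠ 0 → R z = (qmap B κ z : K)) :
    ∃ e : ℕ → K, (∀ i, ‖e i‖ = ‖c‖) ∧ (∀ i, ¬ EquicontinuousIteratesAt R (e i : OnePoint K)) ∧
      ∀ i j, i < j → ‖c‖ ≤ ‖e i - e j‖ := by
  have hpos := h.pos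
  obtain ⟨e₀, he₀, he₀1⟩ := exists_qmap_eq_of_norm_one h (y := 1) (by simp)
  choose g hg using fun t : {t : K // ‖t‖ = ‖c‖} => exists_preimage_on_circle h t.2
  let e' : ℕ → {t : K // ‖t‖ = ‖c‖} := fun i => (fun t => ⟨g t, (hg t).1⟩)^[i] ⟨e₀, he₀⟩
  have hsucc : ∀ i, (e' (i + 1) : K) = g (e' i) := fun i => by
    simp only [e', Function.iterate_succ_apply']
  have hgood : ∀ {z : K}, ‖z‖ = ‖c‖ → Good c z := fun hz => .inr (.inl hz)
  have hback : ∀ {z : K}, ‖z‖ = ‖c‖ → ‖qmap B κ z - 1‖ < 1 →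
      ‖qmap B κ (qmap B κ z)‖ ≤ 1 → ¬ EquicontinuousIteratesAt R (qmap B κ (qmap B κ z) : K) →
      ¬ EquicontinuousIteratesAt R (z : OnePoint K) := fun {z} hz hz1 hz2 hN hE => by
    have hg1 : Good c (qmap B κ z) := .inr (.inr hz1)
    exact hN (((hE.qmap h hR (h.add_ne_zero (hgood hz)) (h.norm_le_one (hgood hz))
      (h.norm_le_one hg1)).qmap h hR (h.add_ne_zero hg1) (h.norm_le_one hg1) hz2))
  have h0 : (e' 0 : K) = e₀ := rfl
  have hnear : ∀ i, ‖qmap B κ (e' i) - 1‖ < 1 := by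
    rintro (_ | i)
    · rw [h0, he₀1]; simp
    · rw [hsucc]; exact (hg _).2.1
  refine ⟨fun i => e' i, fun i => (e' i).2, fun i => ?_, fun i => ?_⟩
  · induction i with
    | zero =>
      refine hback he₀ (hnear 0) ?_ ?_ <;> simp only [h0, he₀1, qmap_one]
      · simp
      · exact not_equicontinuousIteratesAt_zero h hR
    | succ i ih =>
      refine hback (e' (i + 1)).2 (hnear _) ?_ ?_ <;> simp only [hsucc, (hg _).2.2]
      · rw [(e' i).2]; exact h.c_lt.le
      · exact ih
  · have hstep : ∀ i j, ‖(e' i : K) - e' j‖ < ‖c‖ →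
        ‖qmap B κ (qmap B κ (e' i)) - qmap B κ (qmap B κ (e' j))‖ < ‖c‖ := fun i j hij => by
      rw [h.norm_sub_one (hnear i) (hnear j)]
      exact (h.norm_sub_mid_le (e' i).2 (e' j).2).trans_lt hij
    have hsucc2 : ∀ i, qmap B κ (qmap B κ (e' (i + 1))) = e' i := fun i => by
      rw [hsucc, (hg _).2.2]
    induction i with
    | zero =>
      rintro (_ | j) hj
      · omega
      by_contra! hcon
      have := hstep _ _ hcon
      rw [hsucc2, h0, he₀1, qmap_one, zero_sub, norm_neg, (e' j).2] at this
      exact lt_irrefl _ this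
    | succ i ih =>
      rintro (_ | j) hj
      · omega
      by_contra! hcon
      have := hstep _ _ hcon
      rw [hsucc2, hsucc2] at this
      exact (ih j (by omega)).not_gt this

/-- A point whose orbit stays in the good region, has bounded disk radii, and makes arbitrarily long
passages through the neighbourhood of the repelling fixed point `0` before it comes back to the
circle `‖z‖ = ‖c‖`, lies in a wandering component. -/
theorem wandering_of_orbit (h : IsModel c B κ)
    (hR : ∀ z : K, z + κ ≠ 0 → R z = (qmap B κ z : K)) {x : K} {r : ℝ} (hr : 0 < r)
    (hx : ∀ i, Good c ((qmap B κ)^[i] x)) (hrad : ∀ i, orbitRad B κ x r i ≤ ‖c‖ ^ 2)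
    (hT : ∀ d, ∃ T, d ≤ T ∧ ∀ j ≤ d, ‖(qmap B κ)^[T - j] x‖ = ‖c‖ ^ (1 + 2 * j) ∧
      orbitRad B κ x r (T - j) ≤ ‖c‖ ^ (5 + 2 * j)) :
    ∃ U : Set (OnePoint K), IsWanderingComponent R U ∧ openDisk x r ⊆ U ∧
      (∀ n : ℕ, ∃ (y : K) (s : ℝ), 0 < s ∧ R^[n] '' openDisk x r = openDisk y s) ∧
      (∀ m n : ℕ, m < n → Disjoint (R^[m] '' openDisk x r) (R^[n] '' openDisk x r)) := by
  have hpos := h.pos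
  have hlt1 := h.c_lt
  have hsq1 : ‖c‖ ^ 2 < 1 := h.sq_lt.trans h.c_lt
  have hdist : ∀ {z : K}, ‖z - x‖ < r → ∀ n,
      ‖(qmap B κ)^[n] z - (qmap B κ)^[n] x‖ < orbitRad B κ x r n := fun hz n =>
    norm_iterate_sub_lt h hr n (fun i _ => hx i) (fun i _ => hrad i) hz
  have hle1 : ∀ {z : K}, ‖z - x‖ < r → ∀ n, ‖(qmap B κ)^[n] z‖ ≤ 1 := fun hz n => by
    simpa using ultrametric_add_le (((hdist hz n).le.trans (hrad n)).trans hsq1.le)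
      (h.norm_le_one (hx n))
  have hnp : ∀ {z : K}, ‖z - x‖ < r → ∀ n, (qmap B κ)^[n] z + κ ≠ 0 := fun {z} hz n => by
    have h1 := h.le_norm_add (hx n)
    rw [← norm_pos_iff, norm_add_kappa_eq ((hdist hz n).trans_le ((hrad n).trans h1))]
    exact (pow_pos hpos 2).trans_le h1
  have hit : ∀ {z : K}, ‖z - x‖ < r → ∀ n, R^[n] (z : OnePoint K) = ((qmap B κ)^[n] z : K) :=
    fun hz n => iterate_coe hR fun i _ => hnp hz i
  have himg : ∀ n, R^[n] '' openDisk x r = openDisk ((qmap B κ)^[n] x) (orbitRad B κ x r n) := by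
    intro n
    have h1 := (image_iterate_ball h hr n (fun i _ => hx i) (fun i _ => hrad i)).1
    rw [openDisk, openDisk, ← h1, Set.image_image, Set.image_image]
    exact Set.image_congr fun z hz => hit hz n
  have hxr : ‖x - x‖ < r := by simpa using hr
  -- Every point of the disk is a Fatou point, as the iterates are uniformly Lipschitz there.
  have hfatou : openDisk x r ⊆ fatouSet R := by
    have hE : ∀ z : K, ‖z - x‖ < r → EquicontinuousIteratesAt R (z : OnePoint K) := by
      intro z hz ε hε
      refine ⟨min (min r 1) (ε * r), by positivity, fun y hy n => ?_⟩
      obtain ⟨w, rfl, -, hw⟩ := exists_coe_of_chordalDist_lt (hle1 hz 0)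
        ((min_le_left _ _).trans (min_le_right _ _)) hy
      rw [lt_min_iff, lt_min_iff] at hw
      have hw3 : ‖z - w‖ < ε * r := hw.2
      have hwx : ‖w - x‖ < r := by
        simpa using ultrametric_add_lt (by rw [norm_sub_rev]; exact hw.1.1 : ‖w - z‖ < r) hz
      rw [hit hz, hit hwx, chordalDist_coe_of_le (hle1 hz n) (hle1 hwx n)]
      have h1 := (image_iterate_ball h hr n (fun i _ => hx i) (fun i _ => hrad i)).2 z w hz hwx
      have h2 : orbitRad B κ x r n * ‖z - w‖ ≤ 1 * ‖z - w‖ := by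
        gcongr
        exact (hrad n).trans hsq1.le
      nlinarith
    rintro _ ⟨z, hz, rfl⟩
    refine ⟨min r 1, by positivity, fun y hy => ?_⟩
    obtain ⟨w, rfl, -, hw⟩ := exists_coe_of_chordalDist_lt (hle1 hz 0) (min_le_right _ _) hy
    refine hE w ?_
    simpa using ultrametric_add_lt
      (by rw [norm_sub_rev]; exact hw.trans_le (min_le_left _ _) : ‖w - z‖ < r) hz
  set U := analyticComponent (fatouSet R) (x : OnePoint K) with hU
  have hDU : openDisk x r ⊆ U := fun y hy =>
    ⟨openDisk x r, ⟨isConnectedAffinoid_openDisk hr, coe_mem_openDisk.2 hxr, hfatou⟩, hy⟩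
  have hxU : (x : OnePoint K) ∈ U := hDU (coe_mem_openDisk.2 hxr)
  -- At each return to the circle, the component lies in the pullback of one residue disk.
  have hUT : ∀ T, 1 ≤ T → ‖(qmap B κ)^[T - 1] x‖ = ‖c‖ ^ 3 → ∀ y ∈ U,
      ∃ z : K, y = z ∧ (∀ i < T, (qmap B κ)^[i] z + κ ≠ 0) ∧ ‖(qmap B κ)^[T] z‖ = ‖c‖ := by
    intro T hT1 hTn y hy
    have hc3 : ‖c‖ ^ 3 < ‖c‖ ^ 2 := pow_lt_pow_right_of_lt_one₀ hpos hlt1 (by omega)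
    have hsmall : ∀ {w : K}, ‖w‖ = ‖c‖ ^ 3 → ‖w‖ < ‖c‖ ^ 2 := fun hw => hw ▸ hc3
    have hquot : ‖c‖ ^ 3 / ‖c‖ ^ 2 = ‖c‖ := by field_simp
    obtain ⟨ρ, hρ0, -, ha, hb, hc⟩ := exists_pullback h (pow_pos hpos 3) (hc3.trans h.sq_lt)
      (T - 1) x fun i _ => hx i
    obtain ⟨e, he1, he2, he3⟩ := exists_julia_points_on_circle h hR
    have hz0 : ‖(0 : K)‖ < ‖c‖ ^ 2 := by simpa using pow_pos hpos 2
    have hpre : ∀ i, ∃ w : K, ‖w‖ = ‖c‖ ^ 3 ∧ qmap B κ w = e i := fun i => by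
      obtain ⟨w, hw, hwe⟩ := exists_qmap_eq_of_lt h.norm_B (pow_pos hpos 2)
        (h.norm_add_small hz0).ge (t := e i) (by
          rw [h.stretch_small hz0 hsq1.le, qmap_zero, sub_zero, he1,
            mul_one_div_cancel (pow_pos hpos 2).ne']
          exact hlt1)
      rw [sub_zero] at hw
      refine ⟨w, ?_, hwe⟩
      have := h.norm_small hw
      rw [hwe, he1, eq_div_iff (pow_pos hpos 2).ne'] at this
      rw [← this]; ring
    choose w hw hwe using hpre
    choose v hv hvw using fun i => hc (w i) (ultrametric_sub_le (hw i).le hTn.le)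
    have hsub : U ⊆ openDisk x ρ := by
      refine analyticComponent_subset_openDisk v hv (fun i j hij => ?_) fun i hi => ?_
      · by_contra! hcon
        have h1 := hb _ _ (hv i) (hv j) hcon
        rw [hvw, hvw] at h1
        have h2 := h.norm_sub_small (hsmall (hw i)) (hsmall (hw j))
        rw [hwe, hwe] at h2
        have h3 := he3 i j hij
        rw [h2, le_div_iff₀ (pow_pos hpos 2)] at h3
        nlinarith
      · obtain ⟨s, hs, hsE⟩ := hi
        have h1 := (hsE (v i : OnePoint K) (by rwa [chordalDist_self])).iterate_qmap h hR
          (ha _ (hv i)).1 (ha _ (hv i)).2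
        rw [hvw] at h1
        have hwg : Good c (w i) := .inl (hsmall (hw i))
        refine he2 i ?_
        rw [← hwe]
        exact h1.qmap h hR (h.add_ne_zero hwg) (h.norm_le_one hwg)
          (by rw [hwe, he1]; exact hlt1.le)
    obtain ⟨z, hz, rfl⟩ := hsub hy
    have hz' : ‖z - x‖ < ρ := hz
    have h1 := hb z x hz'.le (by simpa using hρ0.le) hz'
    have h2 : ‖(qmap B κ)^[T - 1] z‖ = ‖c‖ ^ 3 := by
      rw [← hTn]
      exact norm_eq_of_norm_sub_lt (hTn ▸ h1)
    obtain ⟨T, rfl⟩ : ∃ T', T = T' + 1 := ⟨T - 1, by omega⟩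
    rw [Nat.add_sub_cancel] at *
    refine ⟨z, rfl, fun i hi => ?_, ?_⟩
    · rcases Nat.lt_succ_iff_lt_or_eq.1 hi with hi | rfl
      · exact (ha z hz'.le).1 i hi
      · exact h.add_ne_zero (.inl (hsmall h2))
    · rw [Function.iterate_succ_apply', h.norm_small (hsmall h2), h2, hquot]
  refine ⟨U, ⟨⟨x, hfatou (coe_mem_openDisk.2 hxr), rfl⟩, ?_⟩, hDU, fun n => ?_, fun m n hmn => ?_⟩
  · rintro ⟨m, n, hmn, heq⟩
    obtain ⟨T, hnT, hTj⟩ := hT n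
    have h3 := (hTj 1 (by omega)).1
    obtain ⟨y, hyU, hy⟩ : R^[m] x ∈ R^[n] '' U := heq ▸ Set.mem_image_of_mem _ hxU
    obtain ⟨z, rfl, hzκ, hzT⟩ := hUT T (by omega) (by simpa using h3) y hyU
    rw [iterate_coe hR fun i hi => hzκ i (by omega), hit hxr, OnePoint.coe_eq_coe] at hy
    have h1 : (qmap B κ)^[T] z = (qmap B κ)^[T - (n - m)] x := by
      have e1 : T = (T - n) + n := by omega
      have e2 : T - (n - m) = (T - n) + m := by omega
      rw [e2, Function.iterate_add_apply, ← hy, ← Function.iterate_add_apply, ← e1]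
    rw [h1, (hTj (n - m) (by omega)).1] at hzT
    have : ‖c‖ ^ (1 + 2 * (n - m)) < ‖c‖ ^ 1 :=
      pow_lt_pow_right_of_lt_one₀ hpos hlt1 (by omega)
    rw [pow_one] at this
    exact this.ne hzT
  · exact ⟨_, _, orbitRad_pos h hr n fun i _ => hx i, himg n⟩
  · rw [Set.disjoint_left]
    rintro _ ⟨_, ⟨z, hz, rfl⟩, rfl⟩ ⟨_, ⟨w, hw, rfl⟩, hzw⟩
    obtain ⟨T, hnT, hTj⟩ := hT n
    have hz' : ‖z - x‖ < r := hz
    have hw' : ‖w - x‖ < r := hw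
    rw [hit hz', hit hw', OnePoint.coe_eq_coe] at hzw
    have h1 : (qmap B κ)^[T] w = (qmap B κ)^[T - (n - m)] z := by
      have e1 : T = (T - n) + n := by omega
      have e2 : T - (n - m) = (T - n) + m := by omega
      rw [e2, Function.iterate_add_apply, ← hzw, ← Function.iterate_add_apply, ← e1]
    have key : ∀ {y : K}, ‖y - x‖ < r → ∀ j ≤ n,
        ‖(qmap B κ)^[T - j] y‖ = ‖c‖ ^ (1 + 2 * j) := fun {y} hy j hj => by
      rw [← (hTj j hj).1]
      refine norm_eq_of_norm_sub_lt ((hdist hy _).trans_le ((hTj j hj).2.trans ?_))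
      rw [(hTj j hj).1]
      exact pow_le_pow_of_le_one hpos.le hlt1.le (by omega)
    have h2 := key hw' 0 (by omega)
    rw [Nat.sub_zero, h1, key hz' (n - m) (by omega)] at h2
    exact (pow_lt_pow_right_of_lt_one₀ hpos hlt1 (by omega : 1 + 2 * 0 < 1 + 2 * (n - m))).ne h2

end Julia

/-! ### A one-parameter family with an almost fixed critical point -/

section Family

variable {K : Type*} [NormedField K]

/-- The parameter `κ` for which `c` is a critical point of `z ↦ (z² - z) / (z + κ)`. -/
def critParam (c : K) : K := c ^ 2 / (1 - 2 * c)

/-- The leading coefficient for which `z ↦ B (z² - z) / (z + κ)` maps `c` to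
`1 + c³ + c⁴`. -/
def lead (c κ : K) : K := (1 + c ^ 3 + c ^ 4) * (c + κ) / (c ^ 2 - c)

/-- The one-parameter family of quadratic maps, with parameter `κ`, whose value at `c` is
`1 + c³ + c⁴` throughout. -/
def fam (c κ : K) : K → K := qmap (lead c κ) κ

/-- The range of the parameter `κ`: so close to `critParam c` that `c` is an approximate critical
point. -/
structure Near (c κ : K) : Prop where
  c_ne : c ≠ 0
  c_lt : ‖c‖ < 1
  norm_two : ‖(2 : K)‖ ≤ ‖c‖ ^ 2
  near : ‖κ - critParam c‖ < ‖c‖ ^ 10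

theorem norm_mul_le_pow {p : ℝ} (hp0 : 0 < p) (hp1 : p < 1) {x y : K} {m n k : ℕ}
    (hx : ‖x‖ ≤ p ^ m) (hy : ‖y‖ ≤ p ^ n) (hk : k ≤ m + n) : ‖x * y‖ ≤ p ^ k := by
  rw [norm_mul]
  calc ‖x‖ * ‖y‖ ≤ p ^ m * p ^ n := by gcongr
    _ = p ^ (m + n) := (pow_add _ _ _).symm
    _ ≤ p ^ k := pow_le_pow_of_le_one hp0.le hp1.le hk

theorem Near.pos {c κ : K} (h : Near c κ) : 0 < ‖c‖ := norm_pos_iff.2 h.c_ne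

/-- In a field of characteristic `0` or `2` alike, the dependence of the family on its parameter
vanishes at `c`. -/
theorem fam_sub_fam {c κ κ' z : K} (hκ : c + κ' ≠ 0) (hz : z + κ ≠ 0) (hz' : z + κ' ≠ 0) :
    fam c κ z - fam c κ' z = fam c κ' z * (κ - κ') * (z - c) / ((c + κ') * (z + κ)) := by
  unfold fam qmap lead
  rcases eq_or_ne (c ^ 2 - c) 0 with h0 | h0
  · simp [h0]
  field_simp
  ring

theorem Near.pow_le {c κ : K} (h : Near c κ) {m n : ℕ} (hmn : n ≤ m) : ‖c‖ ^ m ≤ ‖c‖ ^ n :=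
  pow_le_pow_of_le_one h.pos.le h.c_lt.le hmn

theorem Near.pow_lt {c κ : K} (h : Near c κ) {m n : ℕ} (hmn : n < m) : ‖c‖ ^ m < ‖c‖ ^ n :=
  pow_lt_pow_right_of_lt_one₀ h.pos h.c_lt hmn

theorem Near.pow_le_one {c κ : K} (h : Near c κ) (m : ℕ) : ‖c‖ ^ m ≤ 1 :=
  pow_le_one₀ h.pos.le h.c_lt.le

variable [IsUltrametricDist K]

namespace Near

variable {c κ : K} (h : Near c κ)
include h

theorem norm_one_sub : ‖1 - 2 * c‖ = 1 := by
  have h1 : ‖2 * c‖ ≤ ‖c‖ ^ 3 :=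
    norm_mul_le_pow h.pos h.c_lt h.norm_two (pow_one ‖c‖).ge (by omega)
  have h2 : ‖c‖ ^ 3 < 1 := pow_lt_one₀ h.pos.le h.c_lt (by omega)
  rw [sub_eq_add_neg, norm_add_eq_of_lt] <;> simp only [norm_neg, norm_one]
  exact h1.trans_lt h2

theorem one_sub_ne : 1 - 2 * c ≠ 0 := norm_pos_iff.1 (by rw [h.norm_one_sub]; exact one_pos)

theorem norm_sub_sq_le : ‖κ - c ^ 2‖ ≤ ‖c‖ ^ 5 := by
  have h1 : ‖critParam c - c ^ 2‖ ≤ ‖c‖ ^ 5 := by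
    have e : critParam c - c ^ 2 = 2 * c ^ 3 / (1 - 2 * c) := by
      rw [eq_div_iff h.one_sub_ne, sub_mul, critParam, div_mul_cancel₀ _ h.one_sub_ne]
      ring
    rw [e, norm_div, h.norm_one_sub, div_one]
    exact norm_mul_le_pow h.pos h.c_lt h.norm_two (norm_pow c 3).le (by omega)
  have := ultrametric_add_le (h.near.le.trans (h.pow_le (by omega : 5 ≤ 10))) h1
  rwa [sub_add_sub_cancel] at this

theorem norm_κ : ‖κ‖ = ‖c‖ ^ 2 := by
  rw [← norm_pow]
  refine norm_eq_of_norm_sub_lt (h.norm_sub_sq_le.trans_lt ?_)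
  rw [norm_pow]
  exact h.pow_lt (by omega)

theorem norm_c_add : ‖c + κ‖ = ‖c‖ := by
  refine norm_add_eq_of_lt ?_
  rw [h.norm_κ]
  simpa using h.pow_lt (by omega : 1 < 2)

theorem c_add_ne : c + κ ≠ 0 := norm_pos_iff.1 (by rw [h.norm_c_add]; exact h.pos)

theorem norm_sq_sub : ‖c ^ 2 - c‖ = ‖c‖ := by
  rw [← norm_neg, neg_sub, sub_eq_add_neg]
  refine norm_add_eq_of_lt ?_
  rw [norm_neg, norm_pow]
  simpa using h.pow_lt (by omega : 1 < 2)

theorem sq_sub_ne : c ^ 2 - c ≠ 0 := norm_pos_iff.1 (by rw [h.norm_sq_sub]; exact h.pos)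

theorem norm_critValue_sub : ‖c ^ 3 + c ^ 4‖ = ‖c‖ ^ 3 := by
  rw [norm_add_eq_of_lt, norm_pow]
  rw [norm_pow, norm_pow]
  exact h.pow_lt (by omega)

theorem norm_lead_add : ‖lead c κ + 1‖ ≤ ‖c‖ ^ 3 := by
  have e : lead c κ + 1 =
      ((κ - c ^ 2) + (2 * c ^ 2 + (c ^ 3 + c ^ 4) * (c + κ))) / (c ^ 2 - c) := by
    rw [eq_div_iff h.sq_sub_ne, add_mul, lead, div_mul_cancel₀ _ h.sq_sub_ne]
    ring
  rw [e, norm_div, h.norm_sq_sub, div_le_iff₀ h.pos, ← pow_succ]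
  refine ultrametric_add_le (h.norm_sub_sq_le.trans (h.pow_le (by omega)))
    (ultrametric_add_le ?_ ?_)
  · exact norm_mul_le_pow h.pos h.c_lt h.norm_two (norm_pow c 2).le (by omega)
  · exact norm_mul_le_pow h.pos h.c_lt h.norm_critValue_sub.le
      (n := 1) (by rw [h.norm_c_add, pow_one]) (by omega)

theorem norm_lead : ‖lead c κ‖ = 1 := by
  rw [← norm_one (α := K), ← norm_neg (1 : K)]
  refine norm_eq_of_norm_sub_lt ?_
  rw [sub_neg_eq_add, norm_neg, norm_one]
  exact h.norm_lead_add.trans_lt (pow_lt_one₀ h.pos.le h.c_lt (by omega))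

theorem isModel : IsModel c (lead c κ) κ where
  c_ne := h.c_ne
  c_lt := h.c_lt
  norm_B := h.norm_lead
  norm_B_add := h.norm_lead_add.trans (by simpa using h.pow_le (by omega : 1 ≤ 3))
  norm_κ := h.norm_κ

theorem fam_c : fam c κ c = 1 + c ^ 3 + c ^ 4 := by
  rw [fam, qmap, lead, div_mul_cancel₀ _ h.sq_sub_ne, mul_div_cancel_right₀ _ h.c_add_ne]

theorem norm_fam_c_sub_one : ‖fam c κ c - 1‖ = ‖c‖ ^ 3 := by
  rw [h.fam_c, add_assoc, add_sub_cancel_left, h.norm_critValue_sub]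

theorem norm_crit : ‖c ^ 2 + 2 * κ * c - κ‖ < ‖c‖ ^ 10 := by
  have e : c ^ 2 + 2 * κ * c - κ = -((κ - critParam c) * (1 - 2 * c)) := by
    have e1 : critParam c * (1 - 2 * c) = c ^ 2 := div_mul_cancel₀ _ h.one_sub_ne
    linear_combination -e1
  rw [e, norm_neg, norm_mul, h.norm_one_sub, mul_one]
  exact h.near

theorem norm_fam_sub_mid {z w : K} (hz : ‖z - c‖ < ‖c‖) (hw : ‖w - c‖ < ‖c‖) :
    ‖fam c κ z - fam c κ w‖ = ‖z - w‖ * ‖(c ^ 2 + 2 * κ * c - κ) +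
      ((c + κ) * ((z - c) + (w - c)) + (z - c) * (w - c))‖ / ‖c‖ ^ 2 := by
  have hm := h.isModel
  have hz' := norm_eq_of_norm_sub_lt hz
  have hw' := norm_eq_of_norm_sub_lt hw
  rw [fam, norm_qmap_sub hm.norm_B (hm.add_ne_zero (.inr (.inl hz')))
    (hm.add_ne_zero (.inr (.inl hw'))), hm.norm_add_mid hz', hm.norm_add_mid hw', ← sq]
  congr 3
  ring

theorem norm_fam_sub_fam_c {z : K} (hz : ‖z - c‖ < ‖c‖) (hz3 : ‖c‖ ^ 3 ≤ ‖z - c‖) :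
    ‖fam c κ z - fam c κ c‖ = ‖z - c‖ ^ 2 / ‖c‖ := by
  have hp := h.pos
  rw [h.norm_fam_sub_mid hz (by simpa using hp), sub_self, add_zero, mul_zero, add_zero,
    add_comm, norm_add_eq_of_lt, norm_mul, h.norm_c_add]
  · field_simp
  · rw [norm_mul, h.norm_c_add]
    calc _ < ‖c‖ ^ 10 := h.norm_crit
      _ ≤ ‖c‖ ^ 4 := h.pow_le (by omega)
      _ = ‖c‖ * ‖c‖ ^ 3 := by ring
      _ ≤ _ := by gcongr

theorem norm_fam_sub_fam_c_le {z : K} (hz : ‖z - c‖ ≤ ‖c‖ ^ 3) :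
    ‖fam c κ z - fam c κ c‖ ≤ ‖c‖ ^ 5 := by
  have hp := h.pos
  have hzc : ‖z - c‖ < ‖c‖ := hz.trans_lt (by simpa using h.pow_lt (by omega : 1 < 3))
  rw [h.norm_fam_sub_mid hzc (by simpa using hp), sub_self, add_zero, mul_zero, add_zero,
    div_le_iff₀ (by positivity)]
  calc _ ≤ ‖c‖ ^ 3 * ‖c‖ ^ 4 := by
        gcongr
        refine ultrametric_add_le (h.norm_crit.le.trans (h.pow_le (by omega))) ?_
        exact norm_mul_le_pow h.pos h.c_lt (m := 1) (by rw [h.norm_c_add, pow_one]) hz (by omega)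
    _ = _ := by ring

theorem norm_fam_sub_fam_c_lt {z : K} (hz : ‖z - c‖ < ‖c‖ ^ 2) :
    ‖fam c κ z - fam c κ c‖ < ‖c‖ ^ 3 := by
  have hp := h.pos
  have hzc : ‖z - c‖ < ‖c‖ := hz.trans (by simpa using h.pow_lt (by omega : 1 < 2))
  rcases le_total ‖z - c‖ (‖c‖ ^ 3) with h3 | h3
  · exact (h.norm_fam_sub_fam_c_le h3).trans_lt (h.pow_lt (by omega))
  · rw [h.norm_fam_sub_fam_c hzc h3, div_lt_iff₀ hp]
    calc ‖z - c‖ ^ 2 < (‖c‖ ^ 2) ^ 2 := by gcongr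
      _ = _ := by ring

theorem norm_fam_sub_one {z : K} (hz : ‖z - c‖ < ‖c‖ ^ 2) : ‖fam c κ z - 1‖ = ‖c‖ ^ 3 := by
  rw [← h.norm_fam_c_sub_one]
  apply norm_eq_of_norm_sub_lt
  rw [sub_sub_sub_cancel_right, h.norm_fam_c_sub_one]
  exact h.norm_fam_sub_fam_c_lt hz

theorem norm_fam_sub_one_lt {z : K} (hz : ‖z - c‖ < ‖c‖ ^ 2) : ‖fam c κ z - 1‖ < 1 := by
  rw [h.norm_fam_sub_one hz]; exact pow_lt_one₀ h.pos.le h.c_lt (by omega)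

theorem norm_fam_fam {z : K} (hz : ‖z - c‖ < ‖c‖ ^ 2) : ‖fam c κ (fam c κ z)‖ = ‖c‖ ^ 3 := by
  rw [← h.norm_fam_sub_one hz]
  exact h.isModel.norm_near_one (h.norm_fam_sub_one_lt hz)

theorem norm_fam_fam_lt {z : K} (hz : ‖z - c‖ < ‖c‖ ^ 2) :
    ‖fam c κ (fam c κ z)‖ < ‖c‖ ^ 2 := by
  rw [h.norm_fam_fam hz]; exact h.pow_lt (by omega)

/-- The value `1 + c³ + c⁴` at `c` is chosen so that the third iterate almost fixes `c`. -/
theorem norm_third_c_sub_le : ‖fam c κ (fam c κ (fam c κ c)) - c‖ ≤ ‖c‖ ^ 3 := by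
  have hp := h.pos
  have hlt := h.c_lt
  have hm := h.isModel
  have hc0 : ‖c - c‖ < ‖c‖ ^ 2 := by simpa using pow_pos hp 2
  obtain ⟨w, hw⟩ : ∃ w, w = fam c κ (fam c κ c) := ⟨_, rfl⟩
  have hwn : ‖w‖ = ‖c‖ ^ 3 := by rw [hw, h.norm_fam_fam hc0]
  have hw2 : ‖w‖ < ‖c‖ ^ 2 := hwn.trans_lt (h.pow_lt (by omega))
  have hwκ : w + κ ≠ 0 := hm.add_ne_zero (.inl hw2)
  have hv1 := h.norm_fam_sub_one_lt hc0
  have hvκ : 1 + c ^ 3 + c ^ 4 + κ ≠ 0 := h.fam_c ▸ hm.add_ne_zero (.inr (.inr hv1))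
  have hvκn : ‖1 + c ^ 3 + c ^ 4 + κ‖ = 1 := h.fam_c ▸ hm.norm_add_one hv1
  have hvn : ‖1 + c ^ 3 + c ^ 4‖ = 1 := h.fam_c ▸ norm_eq_one_of_lt hv1
  have hle1 : ‖(1 : K)‖ ≤ ‖c‖ ^ 0 := by simp
  have hc1 : ‖c‖ ≤ ‖c‖ ^ 1 := by simp
  have hcn : ∀ n, ‖c ^ n‖ ≤ ‖c‖ ^ n := fun n => (norm_pow c n).le
  have hwh : ‖w + (c ^ 3 + c ^ 4)‖ ≤ ‖c‖ ^ 5 := by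
    have e : w + (c ^ 3 + c ^ 4) = (c ^ 3 + c ^ 4) *
        ((lead c κ + 1) * (1 + c ^ 3 + c ^ 4) + κ) / (1 + c ^ 3 + c ^ 4 + κ) := by
      rw [hw, h.fam_c, fam, qmap]
      field_simp
      ring
    rw [e, norm_div, hvκn, div_one]
    refine norm_mul_le_pow hp hlt h.norm_critValue_sub.le (n := 2) ?_ (by omega)
    refine ultrametric_add_le ?_ h.norm_κ.le
    exact norm_mul_le_pow hp hlt h.norm_lead_add (n := 0) (by simp [hvn]) (by omega)
  have e : fam c κ w - c = ((lead c κ + 1) * (w * (w - 1)) - w * w +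
      (1 - c) * (w + (c ^ 3 + c ^ 4)) - (2 * c ^ 3 - c ^ 5 + c * (κ - c ^ 2))) / (w + κ) := by
    rw [fam, qmap]
    field_simp
    ring
  have h1c : ‖1 - c‖ ≤ ‖c‖ ^ 0 := by
    rw [pow_zero]; exact ultrametric_sub_le (by simp) hlt.le
  have hw1 : ‖w - 1‖ ≤ ‖c‖ ^ 0 := by
    rw [pow_zero]; exact ultrametric_sub_le (hwn.le.trans (h.pow_le_one 3)) (by simp)
  rw [← hw, e, norm_div, hm.norm_add_small hw2, div_le_iff₀ (by positivity), ← pow_add]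
  refine ultrametric_sub_le (ultrametric_add_le (ultrametric_sub_le ?_ ?_) ?_)
    (ultrametric_add_le (ultrametric_sub_le ?_ (hcn 5)) ?_)
  · exact norm_mul_le_pow hp hlt h.norm_lead_add
      (norm_mul_le_pow hp hlt hwn.le hw1 le_rfl) (by omega)
  · exact norm_mul_le_pow hp hlt hwn.le hwn.le (by omega)
  · exact norm_mul_le_pow hp hlt h1c hwh (by omega)
  · exact norm_mul_le_pow hp hlt h.norm_two (hcn 3) (by omega)
  · exact norm_mul_le_pow hp hlt hc1 h.norm_sub_sq_le (by omega)

theorem norm_third_sub_third_c {z : K} (hz : ‖z - c‖ < ‖c‖ ^ 2) :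
    ‖fam c κ (fam c κ (fam c κ z)) - fam c κ (fam c κ (fam c κ c))‖ =
      ‖fam c κ z - fam c κ c‖ / ‖c‖ ^ 2 := by
  have hm := h.isModel
  have hc0 : ‖c - c‖ < ‖c‖ ^ 2 := by simpa using pow_pos h.pos 2
  refine (hm.norm_sub_small (h.norm_fam_fam_lt hz) (h.norm_fam_fam_lt hc0)).trans ?_
  congr 1
  exact hm.norm_sub_one (h.norm_fam_sub_one_lt hz) (h.norm_fam_sub_one_lt hc0)

theorem norm_third_sub_le {z : K} (hz : ‖z - c‖ ≤ ‖c‖ ^ 3) :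
    ‖fam c κ (fam c κ (fam c κ z)) - c‖ ≤ ‖c‖ ^ 3 := by
  have h1 := h.norm_third_sub_third_c (hz.trans_lt (h.pow_lt (by omega)))
  have h2 := h.norm_fam_sub_fam_c_le hz
  have h3 : ‖fam c κ (fam c κ (fam c κ z)) - fam c κ (fam c κ (fam c κ c))‖ ≤ ‖c‖ ^ 3 := by
    rw [h1, div_le_iff₀ (pow_pos h.pos 2), ← pow_add]
    exact h2
  simpa using ultrametric_add_le h3 h.norm_third_c_sub_le

/-- Outside the disk of radius `‖c‖³`, on which its reduction is `y ↦ y² + const`, the third iterate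
squares the rescaled distance to `c`. -/
theorem norm_third_sub {z : K} (hz3 : ‖c‖ ^ 3 < ‖z - c‖) (hz : ‖z - c‖ < ‖c‖ ^ 2) :
    ‖fam c κ (fam c κ (fam c κ z)) - c‖ = ‖z - c‖ ^ 2 / ‖c‖ ^ 3 := by
  have hp := h.pos
  have hzc : ‖z - c‖ < ‖c‖ := hz.trans (by simpa using h.pow_lt (by omega : 1 < 2))
  have h1 := h.norm_third_sub_third_c hz
  rw [h.norm_fam_sub_fam_c hzc hz3.le, div_div, ← pow_succ'] at h1
  rw [← h1, ← sub_add_sub_cancel _ (fam c κ (fam c κ (fam c κ c))) c]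
  refine norm_add_eq_of_lt (h.norm_third_c_sub_le.trans_lt ?_)
  rw [h1, lt_div_iff₀ (by positivity), ← sq]
  gcongr

/-- Near `c` the maps contract: this uses that `2` is small. -/
theorem norm_bilin_le {z w : K} (hz3 : ‖c‖ ^ 3 ≤ ‖z - c‖)
    (hwz : ‖w - c‖ = ‖z - c‖) (hzw : ‖z - w‖ ≤ ‖c‖ ^ 5) :
    ‖(c ^ 2 + 2 * κ * c - κ) + ((c + κ) * ((z - c) + (w - c)) + (z - c) * (w - c))‖ ≤
      ‖z - c‖ ^ 2 := by
  have hp := h.pos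
  have h6 : ‖c‖ ^ 6 ≤ ‖z - c‖ ^ 2 := by
    calc ‖c‖ ^ 6 = (‖c‖ ^ 3) ^ 2 := by ring
      _ ≤ _ := by gcongr
  have e : (z - c) + (w - c) = 2 * (w - c) + (z - w) := by ring
  rw [e, mul_add]
  refine ultrametric_add_le (h.norm_crit.le.trans ((h.pow_le (by omega)).trans h6))
    (ultrametric_add_le (ultrametric_add_le ?_ ?_) ?_)
  · rw [norm_mul, norm_mul, h.norm_c_add, hwz]
    calc ‖c‖ * (‖(2 : K)‖ * ‖z - c‖) ≤ ‖c‖ * (‖c‖ ^ 2 * ‖z - c‖) := by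
          gcongr; exact h.norm_two
      _ = ‖c‖ ^ 3 * ‖z - c‖ := by ring
      _ ≤ ‖z - c‖ * ‖z - c‖ := by gcongr
      _ = _ := (sq _).symm
  · refine le_trans ?_ h6
    exact norm_mul_le_pow hp h.c_lt (m := 1) (by rw [h.norm_c_add, pow_one]) hzw (by omega)
  · rw [norm_mul, hwz, sq]

theorem norm_sub_eq_of_close {z w : K} (hz3 : ‖c‖ ^ 3 ≤ ‖z - c‖) (hzw : ‖z - w‖ ≤ ‖c‖ ^ 5) :
    ‖w - c‖ = ‖z - c‖ := by
  refine norm_eq_of_norm_sub_lt ?_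
  rw [sub_sub_sub_cancel_right, norm_sub_rev]
  exact (hzw.trans_lt (h.pow_lt (by omega))).trans_le hz3

theorem norm_fam_sub_close {z w : K} (hz3 : ‖c‖ ^ 3 ≤ ‖z - c‖) (hz : ‖z - c‖ < ‖c‖)
    (hzw : ‖z - w‖ ≤ ‖c‖ ^ 5) :
    ‖fam c κ z - fam c κ w‖ ≤ ‖z - c‖ ^ 2 / ‖c‖ ^ 2 * ‖z - w‖ := by
  have hwz := h.norm_sub_eq_of_close hz3 hzw
  have hp := h.pos
  rw [h.norm_fam_sub_mid hz (hwz ▸ hz), mul_comm, div_mul_eq_mul_div]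
  gcongr
  exact h.norm_bilin_le hz3 hwz hzw

theorem stretch_le {z : K} {ρ : ℝ} (hz3 : ‖c‖ ^ 3 ≤ ‖z - c‖) (hz : ‖z - c‖ < ‖c‖)
    (hρ : ρ ≤ ‖z - c‖ ^ 2 / ‖c‖) : stretch κ z ρ ≤ ‖z - c‖ ^ 2 / ‖c‖ ^ 2 := by
  have hp := h.pos
  rw [stretch, h.isModel.norm_add_mid (norm_eq_of_norm_sub_lt hz)]
  gcongr
  refine max_le ?_ ?_
  · have e : z ^ 2 + 2 * κ * z - κ = (c ^ 2 + 2 * κ * c - κ) +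
        ((c + κ) * ((z - c) + (z - c)) + (z - c) * (z - c)) := by ring
    rw [e]
    exact h.norm_bilin_le hz3 rfl (by simp)
  · rwa [le_div_iff₀ hp, mul_comm] at hρ

end Near

section TwoParameters

variable {c κ κ' : K} (h : Near c κ) (h' : Near c κ')
include h h'

theorem norm_fam_sub_fam {z : K} (hz : Good c z) :
    ‖fam c κ z - fam c κ' z‖ = ‖fam c κ' z‖ * ‖κ - κ'‖ * ‖z - c‖ / (‖c‖ * ‖z + κ‖) := by
  rw [fam_sub_fam h'.c_add_ne (h.isModel.add_ne_zero hz) (h'.isModel.add_ne_zero hz), norm_div,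
    norm_mul, norm_mul, norm_mul, h'.norm_c_add]

theorem norm_fam_sub_fam_mid {z : K} (hz : ‖z - c‖ < ‖c‖) :
    ‖fam c κ z - fam c κ' z‖ = ‖z - c‖ / ‖c‖ ^ 2 * ‖κ - κ'‖ := by
  have hp := h.pos
  have hzc := norm_eq_of_norm_sub_lt hz
  have h1 : ‖fam c κ' z‖ = 1 := by
    rw [fam, qmap, norm_div, norm_mul, h'.norm_lead, h'.isModel.norm_add_mid hzc,
      ← norm_neg (z ^ 2 - z), neg_sub, sub_eq_add_neg, norm_add_eq_of_lt, hzc]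
    · field_simp
    · rw [norm_neg, norm_pow, hzc]
      simpa using h.pow_lt (by omega : 1 < 2)
  rw [norm_fam_sub_fam h h' (.inr (.inl hzc)), h1, h.isModel.norm_add_mid hzc]
  ring

theorem norm_fam_sub_fam_one {y : K} (hy : ‖y - 1‖ < 1) :
    ‖fam c κ y - fam c κ' y‖ = ‖y - 1‖ / ‖c‖ * ‖κ - κ'‖ := by
  have hy1 := norm_eq_one_of_lt hy
  have hyc : ‖y - c‖ = 1 := by
    rw [sub_eq_add_neg, norm_add_eq_of_lt (by rw [norm_neg, hy1]; exact h.c_lt), hy1]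
  rw [norm_fam_sub_fam h h' (.inr (.inr hy)), hyc, h.isModel.norm_add_one hy,
    show ‖fam c κ' y‖ = ‖y - 1‖ from h'.isModel.norm_near_one hy]
  ring

theorem norm_fam_sub_fam_small {w : K} (hw : ‖w‖ < ‖c‖ ^ 2) :
    ‖fam c κ w - fam c κ' w‖ = ‖w‖ / ‖c‖ ^ 4 * ‖κ - κ'‖ := by
  have hp := h.pos
  have hwc : ‖w - c‖ = ‖c‖ := by
    rw [norm_sub_rev, sub_eq_add_neg, norm_add_eq_of_lt]
    rw [norm_neg]
    exact hw.trans (by simpa using h.pow_lt (by omega : 1 < 2))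
  rw [norm_fam_sub_fam h h' (.inl hw), hwc, h.isModel.norm_add_small hw,
    show ‖fam c κ' w‖ = ‖w‖ / ‖c‖ ^ 2 from h'.isModel.norm_small hw]
  field_simp

theorem norm_fam_sub_fam_of_one {y y' : K} (hy : ‖y - 1‖ < 1) (hy' : ‖y' - 1‖ < 1)
    (hlt : ‖y' - 1‖ / ‖c‖ * ‖κ - κ'‖ < ‖y - y'‖) : ‖fam c κ y - fam c κ' y'‖ = ‖y - y'‖ := by
  have h1 : ‖fam c κ y - fam c κ y'‖ = ‖y - y'‖ := h.isModel.norm_sub_one hy hy'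
  rw [← sub_add_sub_cancel _ (fam c κ y'), norm_add_eq_of_lt, h1]
  rwa [h1, norm_fam_sub_fam_one h h' hy']

theorem norm_fam_sub_fam_of_small {w w' : K} (hw : ‖w‖ < ‖c‖ ^ 2) (hw' : ‖w'‖ < ‖c‖ ^ 2)
    (hlt : ‖w'‖ / ‖c‖ ^ 4 * ‖κ - κ'‖ < ‖w - w'‖ / ‖c‖ ^ 2) :
    ‖fam c κ w - fam c κ' w'‖ = ‖w - w'‖ / ‖c‖ ^ 2 := by
  have h1 : ‖fam c κ w - fam c κ w'‖ = ‖w - w'‖ / ‖c‖ ^ 2 := h.isModel.norm_sub_small hw hw'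
  rw [← sub_add_sub_cancel _ (fam c κ w'), norm_add_eq_of_lt, h1]
  rwa [h1, norm_fam_sub_fam_small h h' hw']

/-- Dependence of one return to a neighbourhood of `c` on the point and on the parameter. -/
theorem norm_third_sub_third_le {z z' : K} (hz3 : ‖c‖ ^ 3 ≤ ‖z - c‖) (hz : ‖z - c‖ < ‖c‖ ^ 2)
    (hzz : ‖z - z'‖ ≤ ‖c‖ ^ 5) :
    ‖fam c κ (fam c κ (fam c κ z)) - fam c κ' (fam c κ' (fam c κ' z'))‖ ≤
      max (‖z - c‖ ^ 2 / ‖c‖ ^ 4 * ‖z - z'‖) (‖z - c‖ / ‖c‖ ^ 4 * ‖κ - κ'‖) := by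
  have hp := h.pos
  have hzc : ‖z - c‖ < ‖c‖ := hz.trans (by simpa using h.pow_lt (by omega : 1 < 2))
  have hz'z := h.norm_sub_eq_of_close hz3 hzz
  set X := ‖z - c‖ with hX
  set d := ‖κ - κ'‖ with hd
  have hd0 : 0 ≤ d := norm_nonneg _
  set S := max (X ^ 2 / ‖c‖ ^ 4 * ‖z - z'‖) (X / ‖c‖ ^ 4 * d) with hS
  have hXS : X / ‖c‖ ^ 4 * d ≤ S := le_max_right _ _
  -- the parameter contributions of the second and the third step are dominated by the first one
  have hdS : d / ‖c‖ ≤ S := by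
    refine le_trans ?_ hXS
    rw [div_mul_eq_mul_div, div_le_div_iff₀ hp (by positivity)]
    calc d * ‖c‖ ^ 4 = ‖c‖ ^ 3 * d * ‖c‖ := by ring
      _ ≤ X * d * ‖c‖ := by gcongr
  have hz'2 : ‖z' - c‖ < ‖c‖ ^ 2 := hz'z ▸ hz
  have y1 : ‖fam c κ z - fam c κ' z'‖ ≤ S * ‖c‖ ^ 2 := by
    rw [← sub_add_sub_cancel _ (fam c κ z')]
    refine ultrametric_add_le ((h.norm_fam_sub_close hz3 hzc hzz).trans ?_) ?_
    · calc X ^ 2 / ‖c‖ ^ 2 * ‖z - z'‖ = X ^ 2 / ‖c‖ ^ 4 * ‖z - z'‖ * ‖c‖ ^ 2 := by field_simp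
        _ ≤ _ := by gcongr; exact le_max_left _ _
    · rw [norm_fam_sub_fam_mid h h' (hz'z ▸ hzc), hz'z]
      calc X / ‖c‖ ^ 2 * d = X / ‖c‖ ^ 4 * d * ‖c‖ ^ 2 := by field_simp
        _ ≤ _ := by gcongr
  have w1 : ‖fam c κ (fam c κ z) - fam c κ' (fam c κ' z')‖ ≤ S * ‖c‖ ^ 2 := by
    rw [← sub_add_sub_cancel _ (fam c κ (fam c κ' z'))]
    refine ultrametric_add_le ?_ ?_
    · exact (h.isModel.norm_sub_one (h.norm_fam_sub_one_lt hz)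
        (h'.norm_fam_sub_one_lt hz'2)).le.trans y1
    · rw [norm_fam_sub_fam_one h h' (h'.norm_fam_sub_one_lt hz'2), h'.norm_fam_sub_one hz'2]
      calc ‖c‖ ^ 3 / ‖c‖ * d = d / ‖c‖ * ‖c‖ ^ 2 * ‖c‖ := by field_simp
        _ ≤ S * ‖c‖ ^ 2 * 1 := by gcongr; exact h.c_lt.le
        _ = _ := mul_one _
  rw [← sub_add_sub_cancel _ (fam c κ (fam c κ' (fam c κ' z')))]
  refine ultrametric_add_le ?_ ?_
  · refine (h.isModel.norm_sub_small (h.norm_fam_fam_lt hz) (h'.norm_fam_fam_lt hz'2)).le.trans ?_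
    rwa [div_le_iff₀ (by positivity)]
  · rw [norm_fam_sub_fam_small h h' (h'.norm_fam_fam_lt hz'2), h'.norm_fam_fam hz'2]
    refine le_trans (le_of_eq ?_) hdS
    field_simp
    exact hd.symm

/-- If the orbit leaves the neighbourhood of `c` at distance `‖c‖²`, its dependence on the
parameter is dominated by the last step. -/
theorem norm_fam_sub_fam_of_exit {z z' : K} (hz : ‖z - c‖ = ‖c‖ ^ 2) (hzz : ‖z - z'‖ ≤ ‖c‖ ^ 5)
    (hlt : ‖c‖ ^ 2 * ‖z - z'‖ < ‖κ - κ'‖) : ‖fam c κ z - fam c κ' z'‖ = ‖κ - κ'‖ := by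
  have hp := h.pos
  have hz3 : ‖c‖ ^ 3 ≤ ‖z - c‖ := by rw [hz]; exact h.pow_le (by omega)
  have hzc : ‖z - c‖ < ‖c‖ := by rw [hz]; simpa using h.pow_lt (by omega : 1 < 2)
  have hz'z := h.norm_sub_eq_of_close hz3 hzz
  have h1 : ‖fam c κ z' - fam c κ' z'‖ = ‖κ - κ'‖ := by
    rw [norm_fam_sub_fam_mid h h' (hz'z ▸ hzc), hz'z, hz]
    field_simp
  rw [← sub_add_sub_cancel _ (fam c κ z'), add_comm, norm_add_eq_of_lt, h1]
  rw [h1]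
  refine (h.norm_fam_sub_close hz3 hzc hzz).trans_lt (lt_of_eq_of_lt ?_ hlt)
  rw [hz]
  field_simp

end TwoParameters

end Family

/-! ### Passages through the neighbourhood of the critical point -/

section Passage

variable {K : Type*} [NormedField K]

theorem orbitRad_add (B κ x : K) (r : ℝ) (m n : ℕ) :
    orbitRad B κ x r (m + n) =
      orbitRad B κ ((qmap B κ)^[m] x) (orbitRad B κ x r m) n := by
  induction n with
  | zero => rfl
  | succ n ih =>
    rw [← add_assoc, orbitRad, orbitRad, ih, ← Function.iterate_add_apply, add_comm n m]

/-- The third iterate of the family, which returns a neighbourhood of `c` to itself. -/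
def third (c κ : K) : K → K := (fam c κ)^[3]

theorem iterate_third (c κ z : K) (j : ℕ) : (third c κ)^[j] z = (fam c κ)^[3 * j] z := by
  rw [third, Function.iterate_mul]

/-- The orbit of `z` returns `M` times to the disk of radius `‖c‖²` around `c`, outside the disk of
radius `‖c‖³`, and then leaves it at distance exactly `‖c‖²`. -/
structure Passage (c κ z : K) (M : ℕ) : Prop where
  lower : ∀ j < M, ‖c‖ ^ 3 < ‖(third c κ)^[j] z - c‖
  upper : ∀ j < M, ‖(third c κ)^[j] z - c‖ < ‖c‖ ^ 2
  exit : ‖(third c κ)^[M] z - c‖ = ‖c‖ ^ 2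

theorem Near.lt_norm_c {c κ : K} (h : Near c κ) {x : ℝ} (hx : x < ‖c‖ ^ 2) : x < ‖c‖ :=
  hx.trans (by simpa using h.pow_lt (by omega : 1 < 2))

variable [IsUltrametricDist K] {c κ : K}

theorem Good.of_sub_lt {z : K} (hz : ‖z - c‖ < ‖c‖) : Good c z :=
  .inr (.inl (norm_eq_of_norm_sub_lt hz))

variable (h : Near c κ)
include h

namespace Near

theorem norm_iterate_third_sub_le {z : K} (hz : ‖z - c‖ ≤ ‖c‖ ^ 3) (j : ℕ) :
    ‖(third c κ)^[j] z - c‖ ≤ ‖c‖ ^ 3 := by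
  induction j with
  | zero => exact hz
  | succ j ih =>
    rw [Function.iterate_succ_apply']
    exact h.norm_third_sub_le ih

theorem norm_iterate_third_sub_le_mul {z : K} {Y : ℝ} (hY : 1 ≤ Y) (hz : ‖z - c‖ ≤ ‖c‖ ^ 3 * Y)
    {M : ℕ} (hM : ∀ i < M, ‖c‖ ^ 3 * Y ^ 2 ^ i < ‖c‖ ^ 2) {j : ℕ} (hj : j ≤ M) :
    ‖(third c κ)^[j] z - c‖ ≤ ‖c‖ ^ 3 * Y ^ 2 ^ j := by
  have hp := h.pos
  induction j with
  | zero => simpa using hz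
  | succ j ih =>
    have ih := ih (by omega)
    rw [Function.iterate_succ_apply']
    rcases le_or_gt ‖(third c κ)^[j] z - c‖ (‖c‖ ^ 3) with h3 | h3
    · exact (h.norm_third_sub_le h3).trans (le_mul_of_one_le_right (by positivity) (one_le_pow₀ hY))
    · refine (h.norm_third_sub h3 (ih.trans_lt (hM j (by omega)))).trans_le ?_
      rw [div_le_iff₀ (by positivity)]
      calc _ ≤ (‖c‖ ^ 3 * Y ^ 2 ^ j) ^ 2 := by gcongr
        _ = ‖c‖ ^ 3 * Y ^ 2 ^ (j + 1) * ‖c‖ ^ 3 := by rw [pow_succ 2 j, pow_mul]; ring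

theorem norm_iterate_third_sub_eq_mul {z : K} {Y : ℝ} (hY : 1 < Y)
    (hz : ‖z - c‖ = ‖c‖ ^ 3 * Y) {M : ℕ} (hM : ∀ i < M, ‖c‖ ^ 3 * Y ^ 2 ^ i < ‖c‖ ^ 2) {j : ℕ}
    (hj : j ≤ M) : ‖(third c κ)^[j] z - c‖ = ‖c‖ ^ 3 * Y ^ 2 ^ j := by
  have hp := h.pos
  induction j with
  | zero => simpa using hz
  | succ j ih =>
    have ih := ih (by omega)
    have h3 : ‖c‖ ^ 3 < ‖(third c κ)^[j] z - c‖ := by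
      rw [ih]
      exact lt_mul_of_one_lt_right (by positivity) (one_lt_pow₀ hY (by positivity))
    rw [Function.iterate_succ_apply']
    refine (h.norm_third_sub h3 (ih.trans_lt (hM j (by omega)))).trans ?_
    rw [ih, div_eq_iff (by positivity), pow_succ 2 j, pow_mul]
    ring

theorem good_of_returns {z : K} {M : ℕ} (hz : ∀ j < M, ‖(third c κ)^[j] z - c‖ < ‖c‖ ^ 2) {n : ℕ}
    (hn : n < 3 * M) : Good c ((fam c κ)^[n] z) := by
  have hj := hz (n / 3) (by omega)
  rw [iterate_third] at hj
  rw [← Nat.div_add_mod n 3, add_comm, Function.iterate_add_apply]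
  have : n % 3 < 3 := Nat.mod_lt _ (by omega)
  interval_cases n % 3
  · exact Good.of_sub_lt (h.lt_norm_c hj)
  · exact .inr (.inr (h.norm_fam_sub_one_lt hj))
  · exact .inl (h.norm_fam_fam_lt hj)

/-- The radii of the images of a small disk during one return to the neighbourhood of `c`. -/
theorem orbitRad_return {z : K} {r : ℝ} (hr : 0 < r) (hz3 : ‖c‖ ^ 3 ≤ ‖z - c‖)
    (hz : ‖z - c‖ < ‖c‖ ^ 2) (hrz : r ≤ ‖z - c‖ ^ 2 / ‖c‖) :
    (∀ i < 3, orbitRad (lead c κ) κ z r i ≤ ‖c‖ ^ 2) ∧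
      orbitRad (lead c κ) κ z r 3 ≤ r * (‖z - c‖ ^ 2 / ‖c‖ ^ 4) := by
  have hp := h.pos
  have hm := h.isModel
  have hr2 : r ≤ ‖c‖ ^ 2 := by
    refine hrz.trans ?_
    rw [div_le_iff₀ hp]
    calc ‖z - c‖ ^ 2 ≤ (‖c‖ ^ 2) ^ 2 := by gcongr
      _ = ‖c‖ ^ 4 := by ring
      _ ≤ ‖c‖ ^ 3 := h.pow_le (by omega)
      _ = _ := by ring
  have hs := h.stretch_le hz3 (h.lt_norm_c hz) hrz
  have hgz := Good.of_sub_lt (h.lt_norm_c hz)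
  have hq : ‖z - c‖ ^ 2 / ‖c‖ ^ 2 ≤ 1 := by
    rw [div_le_one (by positivity)]
    gcongr
    exact (h.lt_norm_c hz).le
  have hr1 : r * stretch κ z r ≤ r * (‖z - c‖ ^ 2 / ‖c‖ ^ 2) := by gcongr
  have hr1' : r * stretch κ z r ≤ ‖c‖ ^ 2 := by
    calc _ ≤ r * 1 := hr1.trans (by gcongr)
      _ ≤ _ := by rwa [mul_one]
  have hr11 : r * stretch κ z r ≤ 1 := hr1'.trans (h.pow_le_one 2)
  have e1 : orbitRad (lead c κ) κ z r 1 = r * stretch κ z r := rfl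
  have e2 : orbitRad (lead c κ) κ z r 2 = r * stretch κ z r := by
    rw [orbitRad, e1]
    exact (congrArg _ (hm.stretch_one (h.norm_fam_sub_one_lt hz) hr11)).trans (mul_one _)
  have e3 : orbitRad (lead c κ) κ z r 3 = r * stretch κ z r * (1 / ‖c‖ ^ 2) := by
    rw [orbitRad, e2]
    exact congrArg _ (hm.stretch_small (h.norm_fam_fam_lt hz) hr11)
  refine ⟨fun i hi => ?_, ?_⟩
  · interval_cases i
    · exact hr2
    · rwa [e1]
    · rwa [e2]
  · rw [e3]
    calc _ ≤ r * (‖z - c‖ ^ 2 / ‖c‖ ^ 2) * (1 / ‖c‖ ^ 2) := by gcongr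
      _ = _ := by field_simp

/-- Each return contracts small disks at least by the factor `‖c‖ ^ 2` times the factor by which the
square of the distance to `c` grows. -/
theorem orbitRad_passage {z : K} {M : ℕ} (hP : Passage c κ z M) {r : ℝ} (hr : 0 < r)
    (hr5 : r ≤ ‖c‖ ^ 5) {j : ℕ} (hj : j ≤ M) :
    (∀ n < 3 * j, orbitRad (lead c κ) κ z r n ≤ ‖c‖ ^ 2) ∧
      orbitRad (lead c κ) κ z r (3 * j) ≤ ‖c‖ ^ (2 * j) * (‖(third c κ)^[j] z - c‖ ^ 2 / ‖c‖) := by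
  have hp := h.pos
  have hlow : ∀ j ≤ M, ‖c‖ ^ 3 ≤ ‖(third c κ)^[j] z - c‖ := fun j hj => by
    rcases hj.lt_or_eq with hj | rfl
    · exact (hP.lower j hj).le
    · rw [hP.exit]; exact h.pow_le (by omega)
  induction j with
  | zero =>
    refine ⟨fun n hn => by omega, ?_⟩
    rw [mul_zero, mul_zero, pow_zero, one_mul, le_div_iff₀ hp]
    calc r * ‖c‖ ≤ ‖c‖ ^ 5 * ‖c‖ := by gcongr
      _ = (‖c‖ ^ 3) ^ 2 := by ring
      _ ≤ _ := by gcongr; exact hlow 0 hj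
  | succ j ih =>
    obtain ⟨ih1, ih2⟩ := ih (by omega)
    have hgood : ∀ {n}, n < 3 * M → Good c ((fam c κ)^[n] z) := h.good_of_returns hP.upper
    have hjl := hP.lower j (by omega)
    have hju := hP.upper j (by omega)
    have hpos : 0 < orbitRad (lead c κ) κ z r (3 * j) :=
      orbitRad_pos h.isModel hr _ fun i hi => hgood (by omega)
    obtain ⟨h1, h2⟩ := h.orbitRad_return hpos hjl.le hju (by
      refine ih2.trans (mul_le_of_le_one_left (by positivity) (h.pow_le_one _)))
    rw [iterate_third] at h1 h2 ih2
    refine ⟨fun n hn => ?_, ?_⟩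
    · rcases lt_or_ge n (3 * j) with hn' | hn'
      · exact ih1 n hn'
      · obtain ⟨i, rfl⟩ := Nat.exists_eq_add_of_le hn'
        rw [orbitRad_add]
        exact h1 i (by omega)
    · rw [mul_add, mul_one, orbitRad_add]
      refine h2.trans ?_
      have h3 := h.norm_third_sub hjl hju
      have e : ‖(third c κ)^[j + 1] z - c‖ = ‖(third c κ)^[j] z - c‖ ^ 2 / ‖c‖ ^ 3 := by
        rw [Function.iterate_succ_apply']; exact h3
      rw [e, iterate_third]
      calc _ ≤ ‖c‖ ^ (2 * j) * (‖(fam c κ)^[3 * j] z - c‖ ^ 2 / ‖c‖) *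
            (‖(fam c κ)^[3 * j] z - c‖ ^ 2 / ‖c‖ ^ 4) := by gcongr
        _ = _ := by rw [mul_add 2 j 1, pow_add]; field_simp

theorem norm_iterate_small {w : K} {M : ℕ} (hw : ‖w‖ < ‖c‖ ^ (2 * M)) {i : ℕ} (hi : i ≤ M) :
    ‖(fam c κ)^[i] w‖ * ‖c‖ ^ (2 * i) = ‖w‖ := by
  have hp := h.pos
  induction i with
  | zero => simp
  | succ i ih =>
    have ih := ih (by omega)
    have hlt : ‖(fam c κ)^[i] w‖ < ‖c‖ ^ 2 := by
      rw [← mul_lt_mul_iff_left₀ (pow_pos hp (2 * i)), ih, ← pow_add]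
      exact hw.trans_le (h.pow_le (by omega))
    rw [Function.iterate_succ_apply', ← ih,
      show ‖fam c κ ((fam c κ)^[i] w)‖ = ‖(fam c κ)^[i] w‖ / ‖c‖ ^ 2 from
        h.isModel.norm_small hlt, mul_add, pow_add]
    field_simp

theorem norm_iterate_small_lt {w : K} {M : ℕ} (hw : ‖w‖ < ‖c‖ ^ (2 * M)) {i : ℕ} (hi : i < M) :
    ‖(fam c κ)^[i] w‖ < ‖c‖ ^ 2 := by
  rw [← mul_lt_mul_iff_left₀ (pow_pos h.pos (2 * i)), h.norm_iterate_small hw hi.le, ← pow_add]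
  exact hw.trans_le (h.pow_le (by omega))

theorem orbitRad_small {w : K} {M : ℕ} (hw : ‖w‖ < ‖c‖ ^ (2 * M)) {r : ℝ}
    (hr : r ≤ ‖c‖ ^ (2 * M + 5)) {i : ℕ} (hi : i ≤ M) :
    orbitRad (lead c κ) κ w r i ≤ ‖c‖ ^ (2 * (M - i) + 5) := by
  have hp := h.pos
  induction i with
  | zero => exact hr
  | succ i ih =>
    have ih := ih (by omega)
    have hs := h.isModel.stretch_small (h.norm_iterate_small_lt hw (i := i) (by omega))
      (ih.trans (h.pow_le_one _))
    refine (congrArg _ hs).trans_le ?_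
    rw [mul_one_div, div_le_iff₀ (by positivity), ← pow_add]
    refine ih.trans_eq ?_
    congr 1
    omega

end Near

omit h in
/-- The dependence of a passage on the starting point and on the parameter. -/
theorem Passage.norm_sub_le {κ' z z' : K} {m M : ℕ} (hP : Passage c κ z M) (h : Near c κ)
    (h' : Near c κ') (hz : ‖z - z'‖ * ‖c‖ ^ (2 * m) = ‖κ - κ'‖)
    (hd : ‖κ - κ'‖ ≤ ‖c‖ ^ (2 * m + 10)) {j : ℕ} (hj : j ≤ M) :
    (‖(third c κ)^[j] z - (third c κ')^[j] z'‖ * ‖c‖ ^ (2 * m + 6) ≤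
        ‖c‖ ^ (2 * j) * ‖(third c κ)^[j] z - c‖ ^ 2 * ‖κ - κ'‖ ∨
      ‖(third c κ)^[j] z - (third c κ')^[j] z'‖ * ‖c‖ ^ 2 < ‖κ - κ'‖) ∧
    ‖(third c κ)^[j] z - (third c κ')^[j] z'‖ ≤ ‖c‖ ^ 5 := by
  have hp := h.pos
  have hupp : ∀ j ≤ M, ‖(third c κ)^[j] z - c‖ ≤ ‖c‖ ^ 2 := fun j hj => by
    rcases hj.lt_or_eq with hj | rfl
    · exact (hP.upper j hj).le
    · exact hP.exit.le
  have hd0 : 0 ≤ ‖κ - κ'‖ := norm_nonneg _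
  -- Both alternatives imply the coarse bound.
  have hcoarse : ∀ j ≤ M, (‖(third c κ)^[j] z - (third c κ')^[j] z'‖ * ‖c‖ ^ (2 * m + 6) ≤
        ‖c‖ ^ (2 * j) * ‖(third c κ)^[j] z - c‖ ^ 2 * ‖κ - κ'‖ ∨
      ‖(third c κ)^[j] z - (third c κ')^[j] z'‖ * ‖c‖ ^ 2 < ‖κ - κ'‖) →
      ‖(third c κ)^[j] z - (third c κ')^[j] z'‖ ≤ ‖c‖ ^ 5 := by
    rintro j hj (hA | hA)
    · rw [← mul_le_mul_iff_left₀ (pow_pos hp (2 * m + 6))]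
      refine hA.trans ?_
      calc _ ≤ 1 * (‖c‖ ^ 2) ^ 2 * ‖c‖ ^ (2 * m + 10) := by
            gcongr
            · exact h.pow_le_one _
            · exact hupp j hj
        _ = ‖c‖ ^ (2 * m + 14) := by ring
        _ ≤ ‖c‖ ^ (2 * m + 11) := h.pow_le (by omega)
        _ = _ := by ring
    · rw [← mul_le_mul_iff_left₀ (pow_pos hp 2), ← pow_add]
      exact (hA.le.trans hd).trans (h.pow_le (by omega))
  refine (fun hA => ⟨hA, hcoarse j hj hA⟩) ?_
  induction j with
  | zero =>
    left
    have h6 : ‖c‖ ^ 6 ≤ ‖z - c‖ ^ 2 := by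
      rcases Nat.eq_zero_or_pos M with rfl | hM
      · rw [show ‖z - c‖ = ‖c‖ ^ 2 from hP.exit, ← pow_mul]; exact h.pow_le (by omega)
      · calc ‖c‖ ^ 6 = (‖c‖ ^ 3) ^ 2 := by ring
          _ ≤ _ := by gcongr; exact (hP.lower 0 hM).le
    rw [pow_add, ← mul_assoc, mul_zero, pow_zero, one_mul, mul_comm _ (‖κ - κ'‖)]
    refine (congrArg (· * ‖c‖ ^ 6) hz).le.trans ?_
    gcongr
    exact h6
  | succ j ih =>
    have hA := ih (by omega)
    have hl := hP.lower j (by omega)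
    have hu := hP.upper j (by omega)
    have h3 := h.norm_third_sub hl hu
    have hmax := norm_third_sub_third_le h h' hl.le hu (hcoarse j (by omega) hA)
    rw [Function.iterate_succ_apply', Function.iterate_succ_apply']
    change ‖third c κ ((third c κ)^[j] z) - c‖ = _ at h3
    change ‖third c κ ((third c κ)^[j] z) - third c κ' ((third c κ')^[j] z')‖ ≤ _ at hmax
    rw [h3]
    set u := ‖(third c κ)^[j] z - c‖
    set D := ‖(third c κ)^[j] z - (third c κ')^[j] z'‖
    set d := ‖κ - κ'‖
    have hu0 : 0 < u := (pow_pos hp 3).trans hl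
    have hu4 : u ^ 2 < ‖c‖ ^ 4 := by
      calc u ^ 2 < (‖c‖ ^ 2) ^ 2 := by gcongr
        _ = _ := by ring
    rcases le_max_iff.1 hmax with hm | hm
    · rcases hA with hA | hA
      · left
        calc _ ≤ u ^ 2 / ‖c‖ ^ 4 * D * ‖c‖ ^ (2 * m + 6) := by gcongr
          _ = u ^ 2 / ‖c‖ ^ 4 * (D * ‖c‖ ^ (2 * m + 6)) := by ring
          _ ≤ u ^ 2 / ‖c‖ ^ 4 * (‖c‖ ^ (2 * j) * u ^ 2 * d) := by gcongr
          _ = _ := by rw [mul_add, pow_add]; field_simp; ring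
      · right
        calc _ ≤ u ^ 2 / ‖c‖ ^ 4 * D * ‖c‖ ^ 2 := by gcongr
          _ ≤ 1 * D * ‖c‖ ^ 2 := by
            gcongr
            rw [div_le_one (by positivity)]
            exact hu4.le
          _ < d := by rwa [one_mul]
    · rcases hd0.eq_or_lt with hd0 | hd0
      · left
        rw [← hd0, mul_zero] at hm
        rw [← hd0, mul_zero, le_antisymm hm (norm_nonneg _), zero_mul]
      · right
        calc _ ≤ u / ‖c‖ ^ 4 * d * ‖c‖ ^ 2 := by gcongr
          _ = u * d / ‖c‖ ^ 2 := by field_simp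
          _ < d := by
            rw [div_lt_iff₀ (by positivity), mul_comm]
            gcongr

omit h in
theorem Passage.of_close {κ' z z' : K} {m M : ℕ} (hP : Passage c κ z M) (h : Near c κ)
    (h' : Near c κ') (hz : ‖z - z'‖ * ‖c‖ ^ (2 * m) = ‖κ - κ'‖)
    (hd : ‖κ - κ'‖ ≤ ‖c‖ ^ (2 * m + 10)) : Passage c κ' z' M := by
  have key : ∀ j ≤ M, ‖(third c κ')^[j] z' - c‖ = ‖(third c κ)^[j] z - c‖ := fun j hj => by
    refine h.norm_sub_eq_of_close ?_ (hP.norm_sub_le h h' hz hd hj).2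
    rcases hj.lt_or_eq with hj | rfl
    · exact (hP.lower j hj).le
    · rw [hP.exit]; exact h.pow_le (by omega)
  exact ⟨fun j hj => by rw [key j hj.le]; exact hP.lower j hj,
    fun j hj => by rw [key j hj.le]; exact hP.upper j hj, by rw [key M le_rfl]; exact hP.exit⟩

omit h in
/-- After a passage that contracts more than the starting point depends on the parameter, the
orbit depends on the parameter as an isometry. -/
theorem Passage.norm_exit_sub {κ' z z' : K} {m M : ℕ} (hP : Passage c κ z M) (h : Near c κ)
    (h' : Near c κ') (hz : ‖z - z'‖ * ‖c‖ ^ (2 * m) = ‖κ - κ'‖)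
    (hd : ‖κ - κ'‖ ≤ ‖c‖ ^ (2 * m + 10)) (hmM : m < M) :
    ‖fam c κ ((third c κ)^[M] z) - fam c κ' ((third c κ')^[M] z')‖ = ‖κ - κ'‖ := by
  have hp := h.pos
  obtain ⟨hA, hB⟩ := hP.norm_sub_le h h' hz hd le_rfl
  rcases (norm_nonneg (κ - κ')).eq_or_lt with hd0 | hd0
  · obtain rfl : κ = κ' := by rwa [eq_comm, norm_sub_eq_zero_iff] at hd0
    rw [← hd0, mul_eq_zero, or_iff_left (pow_pos hp _).ne', norm_sub_eq_zero_iff] at hz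
    rw [hz]
    simp
  · refine norm_fam_sub_fam_of_exit h h' hP.exit hB ?_
    rw [mul_comm]
    rcases hA with hA | hA
    · rw [hP.exit] at hA
      rw [← mul_lt_mul_iff_left₀ (pow_pos hp (2 * m + 4))]
      calc _ = ‖(third c κ)^[M] z - (third c κ')^[M] z'‖ * ‖c‖ ^ (2 * m + 6) := by ring
        _ ≤ _ := hA
        _ = ‖κ - κ'‖ * ‖c‖ ^ (2 * M + 4) := by ring
        _ < _ := by gcongr ?_ * ?_; exact h.pow_lt (by omega)
    · exact hA

omit h in
/-- Near the repelling fixed point the dependence on the parameter is just expanded. -/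
theorem norm_iterate_sub_small {κ' w w' : K} {M : ℕ} (h : Near c κ) (h' : Near c κ')
    (hw : ‖w‖ < ‖c‖ ^ (2 * M)) (hw' : ‖w'‖ < ‖c‖ ^ (2 * M)) (hww : ‖w - w'‖ = ‖κ - κ'‖) {i : ℕ}
    (hi : i ≤ M) :
    ‖(fam c κ)^[i] w - (fam c κ')^[i] w'‖ * ‖c‖ ^ (2 * i) = ‖κ - κ'‖ := by
  have hp := h.pos
  rcases (norm_nonneg (κ - κ')).eq_or_lt with hd0 | hd0
  · obtain rfl : κ = κ' := by rwa [eq_comm, norm_sub_eq_zero_iff] at hd0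
    obtain rfl : w = w' := by rwa [← hd0, norm_sub_eq_zero_iff] at hww
    simp
  induction i with
  | zero => simpa using hww
  | succ i ih =>
    have ih := ih (by omega)
    have h1 := h'.norm_iterate_small hw' (i := i) (by omega)
    rw [Function.iterate_succ_apply', Function.iterate_succ_apply',
      norm_fam_sub_fam_of_small h h' (h.norm_iterate_small_lt hw (by omega))
      (h'.norm_iterate_small_lt hw' (by omega)), ← ih, mul_add, pow_add]
    · field_simp
    · have hw2 : ‖w'‖ < ‖c‖ ^ 2 := hw'.trans_le (h.pow_le (by omega))
      rw [← mul_lt_mul_iff_left₀ (pow_pos hp (2 * i + 4))]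
      calc _ = ‖(fam c κ')^[i] w'‖ * ‖c‖ ^ (2 * i) * ‖κ - κ'‖ := by
            rw [pow_add]; field_simp
        _ = ‖w'‖ * ‖κ - κ'‖ := by rw [h1]
        _ < ‖c‖ ^ 2 * ‖κ - κ'‖ := by gcongr
        _ = _ := by rw [← ih, pow_add]; field_simp

end Passage

/-! ### Construction of the parameter -/

section Construction

variable {K : Type*} [NontriviallyNormedField K] [IsUltrametricDist K]

theorem RatOn.fam {c : K} {s : Set K} {g : K → K} (hs : ∀ κ ∈ s, Near c κ) (hg : RatOn s g)
    (hgood : ∀ κ ∈ s, Good c (g κ)) : RatOn s fun κ => _root_.fam c κ (g κ) := by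
  have hlead : RatOn s fun κ => lead c κ :=
    ((const s _).mul ((const s c).add (id s))).div (const s _) fun κ hκ => (hs κ hκ).sq_sub_ne
  have h2 : RatOn s fun κ => g κ ^ 2 - g κ := by
    simpa only [sq] using (hg.mul hg).sub hg
  exact (hlead.mul h2).div (hg.add (id s)) fun κ hκ =>
    (hs κ hκ).isModel.add_ne_zero (hgood κ hκ)

theorem RatOn.iterate_fam {c : K} {s : Set K} {g : K → K} (hs : ∀ κ ∈ s, Near c κ)
    (hg : RatOn s g) {n : ℕ} (hgood : ∀ κ ∈ s, ∀ i < n, Good c ((_root_.fam c κ)^[i] (g κ))) :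
    RatOn s fun κ => (_root_.fam c κ)^[n] (g κ) := by
  induction n with
  | zero => exact hg
  | succ n ih =>
    simp only [Function.iterate_succ_apply']
    exact (ih fun κ hκ i hi => hgood κ hκ i (by omega)).fam hs fun κ hκ =>
      hgood κ hκ n (by omega)

/-- If the `2 ^ (M + 1)`-th power of `Y` is `p⁻³`, then a point at distance `p³ Y` from `c` needs
exactly `M` returns to come to a distance between `p²` and `p` from `c`. -/
theorem scale_bounds {p Y : ℝ} (hp : 0 < p) (hp1 : p < 1) (hY0 : 0 ≤ Y) {M : ℕ}
    (hY : Y ^ 2 ^ (M + 1) = (p ^ 3)⁻¹) :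
    1 < Y ∧ (∀ i < M, p ^ 3 * Y ^ 2 ^ i < p ^ 2) ∧ (p ^ 3 * Y ^ 2 ^ M) ^ 2 = p ^ 3 ∧
      p ^ 3 * Y ^ 2 ^ M < p := by
  have hY1 : 1 < Y := by
    refine lt_of_pow_lt_pow_left₀ (2 ^ (M + 1)) hY0 ?_
    rw [one_pow, hY]
    exact (one_lt_inv₀ (by positivity)).2 (pow_lt_one₀ hp.le hp1 (by omega))
  have hsq : (p ^ 3 * Y ^ 2 ^ M) ^ 2 = p ^ 3 := by
    rw [mul_pow, ← pow_mul Y, ← pow_succ, hY]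
    field_simp
  refine ⟨hY1, fun i hi => ?_, hsq, ?_⟩
  · refine lt_of_pow_lt_pow_left₀ 4 (by positivity) ?_
    calc (p ^ 3 * Y ^ 2 ^ i) ^ 4 = p ^ 12 * Y ^ 2 ^ (i + 2) := by
          rw [mul_pow, ← pow_mul Y, pow_add]; ring
      _ ≤ p ^ 12 * Y ^ 2 ^ (M + 1) := by
          gcongr 1
          exact pow_le_pow_right₀ hY1.le (pow_le_pow_right₀ one_le_two (by omega))
      _ = p ^ 9 := by rw [hY]; field_simp
      _ < p ^ 8 := pow_lt_pow_right_of_lt_one₀ hp hp1 (by omega)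
      _ = _ := by ring
  · refine lt_of_pow_lt_pow_left₀ 2 hp.le ?_
    rw [hsq]
    exact pow_lt_pow_right_of_lt_one₀ hp hp1 (by omega)

/-- An orbit that leaves the neighbourhood of `c` and hits the zero `1` of the map has made a
passage. -/
theorem Near.passage_of_fam_eq_one {c κ z : K} (h : Near c κ) {M : ℕ}
    (hupper : ∀ j < M, ‖(third c κ)^[j] z - c‖ < ‖c‖ ^ 2)
    (hlt : ‖(third c κ)^[M] z - c‖ < ‖c‖) (h1 : fam c κ ((third c κ)^[M] z) = 1) :
    Passage c κ z M := by
  have hp := h.pos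
  have h2 : ‖c‖ ^ 2 ≤ ‖(third c κ)^[M] z - c‖ := by
    by_contra! hcon
    have := h.norm_fam_sub_one hcon
    rw [h1, sub_self, norm_zero] at this
    exact (pow_pos hp 3).ne this
  have h32 : ‖c‖ ^ 3 < ‖c‖ ^ 2 := h.pow_lt (by omega)
  refine ⟨fun j hj => ?_, hupper, ?_⟩
  · by_contra! hcon
    have := h.norm_iterate_third_sub_le hcon (M - j)
    rw [← Function.iterate_add_apply, Nat.sub_add_cancel hj.le] at this
    exact absurd (h2.trans this) (not_le.2 h32)
  · have h3 := h.norm_fam_sub_fam_c hlt (h32.le.trans h2)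
    rw [h1, norm_sub_rev, h.norm_fam_c_sub_one, eq_div_iff hp.ne'] at h3
    refine (pow_left_inj₀ (norm_nonneg _) (by positivity) two_ne_zero).1 ?_
    rw [← h3]
    ring

/-- A passage followed by a visit close to `1`, hence close to the repelling fixed point `0`:
what happens until the orbit is pushed away from `0`. -/
theorem Passage.escape {c κ z : K} {M : ℕ} (hP : Passage c κ z M) (h : Near c κ) (hM : 0 < M)
    {r : ℝ} (hr : 0 < r) (hr5 : r ≤ ‖c‖ ^ 5)
    (hy : ‖fam c κ ((third c κ)^[M] z) - 1‖ < ‖c‖ ^ (2 * M)) :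
    (∀ n < 4 * M + 2, Good c ((fam c κ)^[n] z) ∧ orbitRad (lead c κ) κ z r n ≤ ‖c‖ ^ 2) ∧
    ∀ j ≤ M,
      ‖(fam c κ)^[4 * M + 2 - j] z‖ = ‖(fam c κ)^[4 * M + 2] z‖ * ‖c‖ ^ (2 * j) ∧
      orbitRad (lead c κ) κ z r (4 * M + 2 - j) ≤ ‖c‖ ^ (5 + 2 * j) := by
  have hp := h.pos
  have hm := h.isModel
  obtain ⟨hrad, hrad3⟩ := h.orbitRad_passage hP hr hr5 le_rfl
  have hexit := hP.exit
  rw [hexit] at hrad3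
  rw [iterate_third] at hy hexit
  have hrad3 : orbitRad (lead c κ) κ z r (3 * M) ≤ ‖c‖ ^ (2 * M + 3) :=
    hrad3.trans_eq (by field_simp; ring)
  have hlt : ‖(fam c κ)^[3 * M] z - c‖ < ‖c‖ := by
    rw [hexit]; simpa using h.pow_lt (by omega : 1 < 2)
  have hy1 : ‖(fam c κ)^[3 * M + 1] z - 1‖ < ‖c‖ ^ (2 * M) := by
    rwa [Function.iterate_succ_apply']
  have hy1' := hy1.trans_le (h.pow_le_one _)
  have hst : stretch κ ((fam c κ)^[3 * M] z) (orbitRad (lead c κ) κ z r (3 * M)) ≤ ‖c‖ ^ 2 := by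
    refine (h.stretch_le (hexit ▸ h.pow_le (by omega)) hlt ?_).trans_eq ?_
    · rw [hexit]
      calc _ ≤ ‖c‖ ^ (2 * M + 3) := hrad3
        _ ≤ ‖c‖ ^ 3 := h.pow_le (by omega)
        _ = _ := by field_simp
    · rw [hexit]; field_simp
  have hgood3 : ∀ n < 3 * M, Good c ((fam c κ)^[n] z) := fun n => h.good_of_returns hP.upper
  have hpos3 := orbitRad_pos hm hr (3 * M) fun i hi => hgood3 i hi
  have hrad31 : orbitRad (lead c κ) κ z r (3 * M + 1) ≤ ‖c‖ ^ (2 * M + 5) := by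
    rw [orbitRad, show 2 * M + 5 = (2 * M + 3) + 2 by omega, pow_add]
    exact mul_le_mul hrad3 hst
      (stretch_pos (hm.add_ne_zero (Good.of_sub_lt hlt)) hpos3).le (by positivity)
  have hrad32 : orbitRad (lead c κ) κ z r (3 * M + 2) ≤ ‖c‖ ^ (2 * M + 5) := by
    refine (congrArg _ (hm.stretch_one hy1' (hrad31.trans (h.pow_le_one _)))).trans_le ?_
    rwa [mul_one]
  have hw : ‖(fam c κ)^[3 * M + 2] z‖ < ‖c‖ ^ (2 * M) := by
    rw [Function.iterate_succ_apply']
    exact (hm.norm_near_one hy1').trans_lt hy1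
  have hit : ∀ i, (fam c κ)^[3 * M + 2 + i] z = (fam c κ)^[i] ((fam c κ)^[3 * M + 2] z) :=
    fun i => by rw [← Function.iterate_add_apply, add_comm]
  have hrd : ∀ i ≤ M, orbitRad (lead c κ) κ z r (3 * M + 2 + i) ≤ ‖c‖ ^ (2 * (M - i) + 5) :=
    fun i hi => by
      rw [orbitRad_add]
      exact h.orbitRad_small hw hrad32 hi
  constructor
  · intro n hn
    rcases lt_or_ge n (3 * M) with h1 | h1
    · exact ⟨hgood3 n h1, hrad n h1⟩
    rcases h1.eq_or_lt with rfl | h1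
    · exact ⟨Good.of_sub_lt hlt, hrad3.trans (h.pow_le (by omega))⟩
    rcases (show 3 * M + 1 ≤ n from h1).eq_or_lt with rfl | h1
    · exact ⟨.inr (.inr hy1'), hrad31.trans (h.pow_le (by omega))⟩
    obtain ⟨i, rfl⟩ := Nat.exists_eq_add_of_le (show 3 * M + 2 ≤ n from h1)
    refine ⟨.inl ?_, (hrd i (by omega)).trans (h.pow_le (by omega))⟩
    rw [hit]
    exact h.norm_iterate_small_lt hw (by omega)
  · intro j hj
    rw [show 4 * M + 2 - j = 3 * M + 2 + (M - j) by omega, show 4 * M + 2 = 3 * M + 2 + M by omega]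
    refine ⟨?_, (hrd (M - j) (by omega)).trans (h.pow_le (by omega))⟩
    rw [hit, hit, ← mul_left_inj' (pow_pos hp (2 * (M - j))).ne', mul_assoc, ← pow_add,
      h.norm_iterate_small hw (Nat.sub_le _ _), show 2 * j + 2 * (M - j) = 2 * M by omega,
      h.norm_iterate_small hw le_rfl]

/-- The starting point of the orbit, as a function of the parameter. Any function that depends on
the parameter as a similarity would do. -/
def startPt (c κ : K) : K := (κ - critParam c) / c ^ 10

/-- The orbit whose dependence on the parameter is controlled. -/
def orb (c κ : K) (n : ℕ) : K := (fam c κ)^[n] (startPt c κ)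

/-- The radii of the images of the disk of radius `‖c‖ ^ 5` around the starting point. -/
def rad (c κ : K) (n : ℕ) : ℝ := orbitRad (lead c κ) κ (startPt c κ) (‖c‖ ^ 5) n

omit [IsUltrametricDist K] in
theorem orb_add (c κ : K) (m n : ℕ) : orb c κ (m + n) = (fam c κ)^[n] (orb c κ m) := by
  rw [orb, orb, ← Function.iterate_add_apply, add_comm]

omit [IsUltrametricDist K] in
theorem rad_add (c κ : K) (m n : ℕ) :
    rad c κ (m + n) = orbitRad (lead c κ) κ (orb c κ m) (rad c κ m) n :=
  orbitRad_add _ _ _ _ _ _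

/-- A stage of the construction: a disk of parameters, of radius `‖c‖ ^ (2 * m)`, which the
`T`-th point of the orbit maps by a similarity to the open unit disk, and up to time `T`
the images of the disk of radius `‖c‖ ^ 5` around the starting point are under control. -/
structure Stage (c κs : K) (m T : ℕ) : Prop where
  c_ne : c ≠ 0
  near : ∀ κ, ‖κ - κs‖ < ‖c‖ ^ (2 * m) → Near c κ
  good : ∀ κ, ‖κ - κs‖ < ‖c‖ ^ (2 * m) → ∀ n < T, Good c (orb c κ n)
  rad_le : ∀ κ, ‖κ - κs‖ < ‖c‖ ^ (2 * m) → ∀ n < T, rad c κ n ≤ ‖c‖ ^ 2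
  rad_T : ∀ κ, ‖κ - κs‖ < ‖c‖ ^ (2 * m) → rad c κ T ≤ ‖c‖ ^ 5
  zero : orb c κs T = 0
  sim : ∀ κ κ', ‖κ - κs‖ < ‖c‖ ^ (2 * m) → ‖κ' - κs‖ < ‖c‖ ^ (2 * m) →
    ‖orb c κ T - orb c κ' T‖ * ‖c‖ ^ (2 * m) = ‖κ - κ'‖
  rat : RatOn {κ | ‖κ - κs‖ < ‖c‖ ^ (2 * m)} fun κ => orb c κ T

variable {c : K}

omit [IsUltrametricDist K] in
theorem stage_zero (hc : c ≠ 0) (hc1 : ‖c‖ < 1) (h2 : ‖(2 : K)‖ ≤ ‖c‖ ^ 2) :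
    Stage c (critParam c) 5 0 := by
  have hp : 0 < ‖c‖ := norm_pos_iff.2 hc
  have e : ∀ κ, orb c κ 0 = (κ - critParam c) / c ^ 10 := fun κ => rfl
  refine ⟨hc, fun κ hκ => ⟨hc, hc1, h2, hκ⟩, by simp, by simp, fun κ _ => le_rfl, by simp [e],
    fun κ κ' _ _ => ?_, ?_⟩
  · rw [e, e, ← sub_div, sub_sub_sub_cancel_right, norm_div, norm_pow]
    exact div_mul_cancel₀ _ (pow_pos hp 10).ne'
  · simp only [e]
    exact ((RatOn.id _).sub (RatOn.const _ _)).div (RatOn.const _ _) fun _ _ => pow_ne_zero _ hc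

variable [IsAlgClosed K]

/-- The orbit point of a stage takes every value of absolute value `‖c‖`. -/
theorem Stage.exists_orb_eq {κs : K} {m T : ℕ} (h : Stage c κs m T) {t : K} (ht : ‖t‖ = ‖c‖) :
    ∃ κ, ‖κ - κs‖ < ‖c‖ ^ (2 * m) ∧ orb c κ T = t := by
  have hp : 0 < ‖c‖ := norm_pos_iff.2 h.c_ne
  have hs : ‖κs - κs‖ < ‖c‖ ^ (2 * m) := by simpa using pow_pos hp (2 * m)
  have hN := h.near κs hs
  -- a parameter at which the orbit point is larger than `t`
  obtain ⟨γ, hγ⟩ := IsAlgClosed.exists_pow_nat_eq c two_pos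
  have hγn : ‖γ‖ ^ 2 = ‖c‖ := by rw [← norm_pow, hγ]
  have hγ1 : ‖γ‖ < 1 := by
    refine lt_of_pow_lt_pow_left₀ 2 one_pos.le ?_
    rw [hγn, one_pow]; exact hN.c_lt
  have hγ0 : 0 < ‖γ‖ := by
    refine norm_pos_iff.2 fun h0 => h.c_ne ?_
    rw [← hγ, h0, zero_pow two_ne_zero]
  have hcγ : ‖c‖ < ‖γ‖ := by
    rw [← hγn, sq]
    exact mul_lt_of_lt_one_left hγ0 hγ1
  have e1 : ‖κs + c ^ (2 * m) * γ - κs‖ = ‖c‖ ^ (2 * m) * ‖γ‖ := by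
    rw [add_sub_cancel_left, norm_mul, norm_pow]
  have h1 : ‖κs + c ^ (2 * m) * γ - κs‖ < ‖c‖ ^ (2 * m) := by
    rw [e1]
    exact mul_lt_of_lt_one_right (by positivity) hγ1
  have h2 := h.sim _ _ h1 hs
  rw [h.zero, sub_zero, e1, mul_comm, mul_right_inj' (pow_pos hp _).ne'] at h2
  obtain ⟨κ, hκ, h0⟩ := (h.rat.sub (RatOn.const _ t)).exists_zero
    (fun r hr => norm_sub_eq_of_notMem_ball hr) hs h1 (by
      rw [h.zero, zero_sub, norm_neg, ht, sub_eq_add_neg (orb _ _ _), norm_add_eq_of_lt, h2]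
      · exact hcγ.ne
      · rwa [norm_neg, ht, h2])
  exact ⟨κ, hκ, sub_eq_zero.1 h0⟩

/-- There are a parameter for which the orbit comes back to `c`, and one for which it comes back so
far from `c` that after `M` returns it is at a distance between `‖c‖²` and `‖c‖` from `c`. In a disk
that contains both there is one for which the orbit hits `1` right after `M` returns. -/
theorem Stage.exists_passage {κs : K} {m T : ℕ} (h : Stage c κs m T) {M : ℕ} (hM : 0 < M) :
    ∃ κ, ‖κ - κs‖ < ‖c‖ ^ (2 * m) ∧ Passage c κ (orb c κ T) M ∧
      fam c κ ((third c κ)^[M] (orb c κ T)) = 1 := by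
  have hp : 0 < ‖c‖ := norm_pos_iff.2 h.c_ne
  have hN := h.near κs (by simpa using pow_pos hp (2 * m))
  obtain ⟨ω, hω⟩ := IsAlgClosed.exists_pow_nat_eq (c ^ 3)⁻¹ (n := 2 ^ (M + 1)) (by positivity)
  obtain ⟨hY, hlt, hsq, hltM⟩ := scale_bounds hp hN.c_lt (norm_nonneg ω) (M := M)
    (by rw [← norm_pow, hω, norm_inv, norm_pow])
  set Y := ‖ω‖ with hYdef
  have hξ : ‖c ^ 3 * ω‖ = ‖c‖ ^ 3 * Y := by rw [norm_mul, norm_pow]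
  have hξ2 : ‖c‖ ^ 3 * Y < ‖c‖ ^ 2 := by simpa using hlt 0 hM
  have hcξ : ‖c + c ^ 3 * ω‖ = ‖c‖ :=
    norm_add_eq_of_lt (by rw [hξ]; exact hN.lt_norm_c hξ2)
  obtain ⟨κc, hκc, hoc⟩ := h.exists_orb_eq rfl
  obtain ⟨κx, hκx, hox⟩ := h.exists_orb_eq hcξ
  set s : Set K := {κ | ‖κ - κc‖ ≤ ‖c‖ ^ 3 * Y * ‖c‖ ^ (2 * m)} with hsdef
  have hs : ∀ κ ∈ s, ‖κ - κs‖ < ‖c‖ ^ (2 * m) := fun κ hκ => by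
    rw [← sub_add_sub_cancel κ κc]
    refine ultrametric_add_lt (lt_of_le_of_lt hκ ?_) hκc
    exact mul_lt_of_lt_one_left (by positivity) (hξ2.trans_le (hN.pow_le_one 2))
  have hz : ∀ κ ∈ s, ‖orb c κ T - c‖ ≤ ‖c‖ ^ 3 * Y := fun κ hκ => by
    have h1 := h.sim κ κc (hs κ hκ) hκc
    rw [hoc] at h1
    rw [← mul_le_mul_iff_left₀ (pow_pos hp (2 * m)), h1]
    exact hκ
  have hret : ∀ κ ∈ s, ∀ j ≤ M,
      ‖(third c κ)^[j] (orb c κ T) - c‖ ≤ ‖c‖ ^ 3 * Y ^ 2 ^ j := fun κ hκ j hj =>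
    (h.near κ (hs κ hκ)).norm_iterate_third_sub_le_mul hY.le (hz κ hκ) hlt hj
  have hup : ∀ κ ∈ s, ∀ j < M, ‖(third c κ)^[j] (orb c κ T) - c‖ < ‖c‖ ^ 2 := fun κ hκ j hj =>
    (hret κ hκ j hj.le).trans_lt (hlt j hj)
  have hrat : RatOn s fun κ => fam c κ ((third c κ)^[M] (orb c κ T)) - 1 := by
    refine RatOn.sub ?_ (RatOn.const _ _)
    refine RatOn.fam (fun κ hκ => h.near κ (hs κ hκ)) ?_ fun κ hκ =>
      Good.of_sub_lt ((hret κ hκ M le_rfl).trans_lt hltM)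
    simp only [iterate_third]
    exact RatOn.iterate_fam (fun κ hκ => h.near κ (hs κ hκ)) (h.rat.mono hs) fun κ hκ i hi =>
      (h.near κ (hs κ hκ)).good_of_returns (hup κ hκ) hi
  have hcs : κc ∈ s := by simp only [hsdef, Set.mem_ofPred_eq, sub_self, norm_zero]; positivity
  have hxs : κx ∈ s := by
    rw [hsdef, Set.mem_ofPred_eq, ← h.sim κx κc hκx hκc, hoc, hox, add_sub_cancel_left, hξ]
  obtain ⟨κ, hκ, h0⟩ := hrat.exists_zero (fun r hr => norm_sub_eq_of_notMem_closedBall hr) hcs hxs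
    (by
      have hNc := h.near κc hκc
      have hNx := h.near κx hκx
      have h3 := hNc.norm_iterate_third_sub_le (z := orb c κc T) (by
        rw [hoc, sub_self, norm_zero]; positivity) M
      rw [hNc.norm_fam_sub_one (h3.trans_lt (hNc.pow_lt (by omega)))]
      have hq := hNx.norm_iterate_third_sub_eq_mul hY (z := orb c κx T)
        (by rw [hox, add_sub_cancel_left, hξ]) hlt le_rfl
      have h4 := hNx.norm_fam_sub_fam_c (z := (third c κx)^[M] (orb c κx T)) (hq.trans_lt hltM) (by
        rw [hq]
        exact le_mul_of_one_le_right (by positivity) (one_le_pow₀ hY.le))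
      rw [hq, hsq, show ‖c‖ ^ 3 / ‖c‖ = ‖c‖ ^ 2 by field_simp] at h4
      rw [← sub_add_sub_cancel _ (fam c κx c) 1, norm_add_eq_of_lt, h4]
      · exact (hNc.pow_lt (by omega)).ne
      · rw [h4, hNx.norm_fam_c_sub_one]
        exact hNx.pow_lt (by omega))
  have hNκ := h.near κ (hs κ hκ)
  have h1 := sub_eq_zero.1 h0
  exact ⟨κ, hs κ hκ, hNκ.passage_of_fam_eq_one (hup κ hκ)
    ((hret κ hκ M le_rfl).trans_lt hltM) h1, h1⟩

/-- One step of the construction: a passage of `m + 5` returns, followed by a run of `m + 5` steps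
away from `0`. The last clause describes that run, for every parameter of the new stage. -/
theorem Stage.exists_next {κs : K} {m T : ℕ} (h : Stage c κs m T) :
    ∃ κ' T', Stage c κ' (m + 5) T' ∧ T + (m + 5) ≤ T' ∧ ‖κ' - κs‖ < ‖c‖ ^ (2 * m) ∧
      ∀ κ, ‖κ - κ'‖ < ‖c‖ ^ (2 * (m + 5)) → ‖orb c κ T‖ = ‖c‖ ∧ ∀ j ≤ m + 5,
        ‖orb c κ (T' - j)‖ = ‖orb c κ T'‖ * ‖c‖ ^ (2 * j) ∧
        rad c κ (T' - j) ≤ ‖c‖ ^ (5 + 2 * j) := by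
  obtain ⟨M, hMdef⟩ : ∃ M, M = m + 5 := ⟨_, rfl⟩
  obtain ⟨κ', hκ', hP', h1'⟩ := h.exists_passage (M := M) (by omega)
  rw [← hMdef]
  have hp : 0 < ‖c‖ := norm_pos_iff.2 h.c_ne
  have hN' := h.near κ' hκ'
  have hself : ‖κ' - κ'‖ < ‖c‖ ^ (2 * M) := by simpa using pow_pos hp (2 * M)
  have hsub : ∀ κ, ‖κ - κ'‖ < ‖c‖ ^ (2 * M) → ‖κ - κs‖ < ‖c‖ ^ (2 * m) := fun κ hκ => by
    rw [← sub_add_sub_cancel κ κ']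
    exact ultrametric_add_lt (hκ.trans (hN'.pow_lt (by omega))) hκ'
  have hclose : ∀ κ κ₁, ‖κ - κ'‖ < ‖c‖ ^ (2 * M) → ‖κ₁ - κ'‖ < ‖c‖ ^ (2 * M) →
      ‖κ - κ₁‖ ≤ ‖c‖ ^ (2 * m + 10) := fun κ κ₁ hκ hκ₁ => by
    rw [← sub_sub_sub_cancel_right κ κ₁ κ', show 2 * m + 10 = 2 * M by omega]
    exact (ultrametric_sub_lt hκ hκ₁).le
  have hnear : ∀ κ, ‖κ - κ'‖ < ‖c‖ ^ (2 * M) → Near c κ := fun κ hκ => h.near κ (hsub κ hκ)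
  have hpass : ∀ κ, ‖κ - κ'‖ < ‖c‖ ^ (2 * M) → Passage c κ (orb c κ T) M := fun κ hκ =>
    hP'.of_close hN' (hnear κ hκ) (h.sim κ' κ hκ' (hsub κ hκ)) (hclose κ' κ hself hκ)
  have hyy : ∀ κ κ₁, ‖κ - κ'‖ < ‖c‖ ^ (2 * M) → ‖κ₁ - κ'‖ < ‖c‖ ^ (2 * M) →
      ‖fam c κ ((third c κ)^[M] (orb c κ T)) - fam c κ₁ ((third c κ₁)^[M] (orb c κ₁ T))‖ =
        ‖κ - κ₁‖ := fun κ κ₁ hκ hκ₁ =>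
    (hpass κ hκ).norm_exit_sub (hnear κ hκ) (hnear κ₁ hκ₁) (h.sim κ κ₁ (hsub κ hκ) (hsub κ₁ hκ₁))
      (hclose κ κ₁ hκ hκ₁) (by omega)
  have hy1 : ∀ κ, ‖κ - κ'‖ < ‖c‖ ^ (2 * M) →
      ‖fam c κ ((third c κ)^[M] (orb c κ T)) - 1‖ = ‖κ - κ'‖ := fun κ hκ => by
    rw [← hyy κ κ' hκ hself, h1']
  have hesc := fun κ hκ => (hpass κ hκ).escape (hnear κ hκ) (by omega)
    (orbitRad_pos (hnear κ hκ).isModel (pow_pos hp 5) T fun i hi => h.good κ (hsub κ hκ) i hi)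
    (h.rad_T κ (hsub κ hκ)) ((hy1 κ hκ).trans_lt hκ)
  have hw : ∀ κ, (fam c κ)^[3 * M + 2] (orb c κ T) =
      fam c κ (fam c κ ((third c κ)^[M] (orb c κ T))) := fun κ => by
    rw [iterate_third, Function.iterate_succ_apply', Function.iterate_succ_apply']
  have hw0 : (fam c κ')^[3 * M + 2] (orb c κ' T) = 0 := by
    rw [hw, h1']; simp [fam, qmap]
  have hww : ∀ κ κ₁, ‖κ - κ'‖ < ‖c‖ ^ (2 * M) → ‖κ₁ - κ'‖ < ‖c‖ ^ (2 * M) →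
      ‖(fam c κ)^[3 * M + 2] (orb c κ T) - (fam c κ₁)^[3 * M + 2] (orb c κ₁ T)‖ = ‖κ - κ₁‖ :=
    fun κ κ₁ hκ hκ₁ => by
    rcases eq_or_ne κ κ₁ with rfl | hne
    · simp
    have hd : 0 < ‖κ - κ₁‖ := norm_pos_iff.2 (sub_ne_zero.2 hne)
    have hlt1 : ‖c‖ ^ (2 * M) ≤ 1 := hN'.pow_le_one _
    rw [hw, hw, norm_fam_sub_fam_of_one (hnear κ hκ) (hnear κ₁ hκ₁), hyy κ κ₁ hκ hκ₁]
    · exact ((hy1 κ hκ).trans_lt hκ).trans_le hlt1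
    · exact ((hy1 κ₁ hκ₁).trans_lt hκ₁).trans_le hlt1
    · rw [hyy κ κ₁ hκ hκ₁]
      refine mul_lt_of_lt_one_left hd ?_
      rw [div_lt_one hp, hy1 κ₁ hκ₁]
      exact hκ₁.trans (by simpa using hN'.pow_lt (by omega : 1 < 2 * M))
  have hwlt : ∀ κ, ‖κ - κ'‖ < ‖c‖ ^ (2 * M) →
      ‖(fam c κ)^[3 * M + 2] (orb c κ T)‖ < ‖c‖ ^ (2 * M) := fun κ hκ => by
    have := hww κ κ' hκ hself
    rw [hw0, sub_zero] at this
    rwa [this]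
  have hlast : ∀ κ, orb c κ (T + (4 * M + 2)) =
      (fam c κ)^[M] ((fam c κ)^[3 * M + 2] (orb c κ T)) := fun κ => by
    rw [orb_add, ← Function.iterate_add_apply, show M + (3 * M + 2) = 4 * M + 2 by omega]
  have hcases : ∀ κ, ‖κ - κ'‖ < ‖c‖ ^ (2 * M) → ∀ n < T + (4 * M + 2),
      Good c (orb c κ n) ∧ rad c κ n ≤ ‖c‖ ^ 2 := fun κ hκ n hn => by
    rcases lt_or_ge n T with hnT | hnT
    · exact ⟨h.good κ (hsub κ hκ) n hnT, h.rad_le κ (hsub κ hκ) n hnT⟩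
    · obtain ⟨i, rfl⟩ := Nat.exists_eq_add_of_le hnT
      rw [orb_add, rad_add]
      exact (hesc κ hκ).1 i (by omega)
  refine ⟨κ', T + (4 * M + 2), ⟨h.c_ne, hnear, fun κ hκ n hn => (hcases κ hκ n hn).1,
    fun κ hκ n hn => (hcases κ hκ n hn).2, fun κ hκ => ?_, ?_, fun κ κ₁ hκ hκ₁ => ?_, ?_⟩,
    by omega, hκ', fun κ hκ => ⟨?_, fun j hj => ?_⟩⟩
  · rw [rad_add]
    exact ((hesc κ hκ).2 0 (Nat.zero_le _)).2
  · have h0 := hN'.norm_iterate_small (hwlt κ' hself) le_rfl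
    rw [← hlast, hw0, norm_zero, mul_eq_zero, or_iff_left (pow_pos hp _).ne', norm_eq_zero] at h0
    exact h0
  · rw [hlast, hlast]
    exact norm_iterate_sub_small (hnear κ hκ) (hnear κ₁ hκ₁) (hwlt κ hκ) (hwlt κ₁ hκ₁)
      (hww κ κ₁ hκ hκ₁) le_rfl
  · simp only [orb_add]
    exact RatOn.iterate_fam hnear (h.rat.mono hsub) fun κ hκ i hi => ((hesc κ hκ).1 i hi).1
  · exact norm_eq_of_norm_sub_lt ((hnear κ hκ).lt_norm_c ((hpass κ hκ).upper 0 (by omega)))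
  · rw [show T + (4 * M + 2) - j = T + (4 * M + 2 - j) by omega, orb_add, orb_add, rad_add]
    exact (hesc κ hκ).2 j hj

/-- The parameter disks of successive stages shrink to a parameter for which the orbit makes
longer and longer passages through the neighbourhood of `0`. -/
theorem exists_param [CompleteSpace K] (hc : c ≠ 0) (hc1 : ‖c‖ < 1) (h2 : ‖(2 : K)‖ ≤ ‖c‖ ^ 2) :
    ∃ κ, Near c κ ∧ (∀ n, Good c (orb c κ n)) ∧ (∀ n, rad c κ n ≤ ‖c‖ ^ 2) ∧
      ∀ d, ∃ T, d ≤ T ∧ ∀ j ≤ d, ‖orb c κ (T - j)‖ = ‖c‖ ^ (1 + 2 * j) ∧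
        rad c κ (T - j) ≤ ‖c‖ ^ (5 + 2 * j) := by
  choose! next time hnext using
    fun (κs : K) (m T : ℕ) (h : Stage c κs m T) => h.exists_next
  have hp : 0 < ‖c‖ := norm_pos_iff.2 hc
  let σ : ℕ → K × ℕ := fun k => Nat.rec (critParam c, 0)
    (fun k s => (next s.1 (5 * (k + 1)) s.2, time s.1 (5 * (k + 1)) s.2)) k
  have hσ : ∀ k, Stage c (σ k).1 (5 * (k + 1)) (σ k).2 := fun k => by
    induction k with
    | zero => exact stage_zero hc hc1 h2
    | succ k ih => exact (hnext _ _ _ ih).1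
  have hstep := fun k => (hnext _ _ _ (hσ k)).2
  have hdist : ∀ k, ‖(σ (k + 1)).1 - (σ k).1‖ < ‖c‖ ^ (2 * (5 * (k + 1))) := fun k =>
    (hstep k).2.1
  have hanti : ∀ k j, ‖(σ (k + j)).1 - (σ k).1‖ < ‖c‖ ^ (2 * (5 * (k + 1))) := fun k j => by
    induction j with
    | zero => simpa using pow_pos hp _
    | succ j ih =>
      rw [← sub_add_sub_cancel _ (σ (k + j)).1]
      exact ultrametric_add_lt ((hdist (k + j)).trans_le
        (pow_le_pow_of_le_one hp.le hc1.le (by omega))) ih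
  obtain ⟨κ, hκ⟩ : ∃ κ, Filter.Tendsto (fun k => (σ k).1) Filter.atTop (nhds κ) := by
    refine cauchySeq_tendsto_of_complete (cauchySeq_of_le_geometric (‖c‖ ^ 10) (‖c‖ ^ 10)
      (pow_lt_one₀ hp.le hc1 (by omega)) fun k => ?_)
    rw [dist_comm, dist_eq_norm, ← pow_mul, ← pow_add]
    exact (hdist k).le.trans_eq (by congr 1; omega)
  have hmem : ∀ k, ‖κ - (σ k).1‖ < ‖c‖ ^ (2 * (5 * (k + 1))) := fun k => by
    have hcl := IsUltrametricDist.isClosed_ball (σ k).1 (‖c‖ ^ (2 * (5 * (k + 1))))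
    have := hcl.mem_of_tendsto hκ (Filter.eventually_atTop.2 ⟨k, fun j hj => by
      obtain ⟨i, rfl⟩ := Nat.exists_eq_add_of_le hj
      rw [Metric.mem_ball, dist_eq_norm]
      exact hanti k i⟩)
    rwa [Metric.mem_ball, dist_eq_norm] at this
  have hT : ∀ k, 5 * k ≤ (σ k).2 := fun k => by
    induction k with
    | zero => simp
    | succ k ih =>
      have h1 : (σ k).2 + (5 * (k + 1) + 5) ≤ (σ (k + 1)).2 := (hstep k).1
      omega
  refine ⟨κ, (hσ 0).near κ (hmem 0), fun n => (hσ (n + 1)).good κ (hmem (n + 1)) n ?_,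
    fun n => (hσ (n + 1)).rad_le κ (hmem (n + 1)) n ?_,
    fun d => ⟨(σ (d + 1)).2, ?_, fun j hj => ?_⟩⟩
  · have := hT (n + 1)
    omega
  · have := hT (n + 1)
    omega
  · have := hT (d + 1)
    omega
  · have h1 := ((hstep d).2.2 κ (hmem (d + 1))).2 j (by omega)
    have h3 := ((hstep (d + 1)).2.2 κ (hmem (d + 2))).1
    change ‖orb c κ ((σ (d + 1)).2 - j)‖ = ‖orb c κ (σ (d + 1)).2‖ * _ ∧
      rad c κ ((σ (d + 1)).2 - j) ≤ _ at h1
    rw [h3] at h1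
    exact ⟨by rw [h1.1, pow_add, pow_one], h1.2⟩

end Construction

/-! ### Choice of the coefficients -/

theorem norm_two_lt_one {K : Type*} [NontriviallyNormedField K] [IsUltrametricDist K]
    [CharP (IsLocalRing.ResidueField (NormedField.valuation (K := K)).valuationSubring) 2] :
    ‖(2 : K)‖ < 1 := by
  set A := (NormedField.valuation (K := K)).valuationSubring
  have h0 : IsLocalRing.residue A 2 = 0 := by
    rw [map_ofNat]
    exact CharP.cast_eq_zero (IsLocalRing.ResidueField A) 2
  rw [IsLocalRing.residue_eq_zero_iff, IsLocalRing.mem_maximalIdeal, mem_nonunits_iff] at h0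
  by_contra! h1
  have h2 : (2 : K) ≠ 0 := norm_pos_iff.1 (one_pos.trans_le h1)
  have hmem : (2 : K)⁻¹ ∈ A := by
    rw [Valuation.mem_valuationSubring_iff, NormedField.valuation_apply, ← NNReal.coe_le_coe,
      coe_nnnorm, norm_inv, NNReal.coe_one]
    exact inv_le_one_of_one_le₀ h1
  exact h0 (IsUnit.of_mul_eq_one ⟨_, hmem⟩ (Subtype.ext (mul_inv_cancel₀ h2)))

/-- In characteristic `2` any small `c` will do, otherwise `c` is a square root of `2`. -/
theorem exists_scale {K : Type*} [NontriviallyNormedField K] [IsAlgClosed K]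
    (h2 : ‖(2 : K)‖ < 1) :
    ∃ c : K, c ≠ 0 ∧ ‖c‖ < 1 ∧ ‖(2 : K)‖ ≤ ‖c‖ ^ 2 ∧ ((2 : K) ≠ 0 → ‖c‖ ^ 2 = ‖(2 : K)‖) := by
  rcases eq_or_ne (2 : K) 0 with h0 | h0
  · obtain ⟨c, hc, hc1⟩ := NormedField.exists_norm_lt_one K
    refine ⟨c, norm_pos_iff.1 hc, hc1, ?_, fun h => absurd h0 h⟩
    rw [h0, norm_zero]
    positivity
  · obtain ⟨c, hc⟩ := IsAlgClosed.exists_pow_nat_eq (2 : K) two_pos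
    have e : ‖c‖ ^ 2 = ‖(2 : K)‖ := by rw [← norm_pow, hc]
    refine ⟨c, ?_, ?_, e.ge, fun _ => e⟩
    · rintro rfl
      exact h0 (by rw [← hc, zero_pow two_ne_zero])
    · refine lt_of_pow_lt_pow_left₀ 2 one_pos.le ?_
      rwa [e, one_pow]

theorem quadRatMap_coe {K : Type*} [NormedField K] {B κ : K} (hB : B ≠ 0) {z : K}
    (hz : z + κ ≠ 0) : quadRatMap (-(B / κ)) B⁻¹ z = (qmap B κ z : K) := by
  have e : B⁻¹ * z - 1 / -(B / κ) = (z + κ) / B := by field_simp; ring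
  refine (if_neg ?_).trans ?_
  · rw [e]
    exact div_ne_zero hz hB
  rw [e, qmap]
  congr 1
  field_simp

theorem theoremA {K : Type*} [NontriviallyNormedField K] [IsUltrametricDist K] [CompleteSpace K]
    [IsAlgClosed K]
    [CharP (IsLocalRing.ResidueField (NormedField.valuation (K := K)).valuationSubring) 2] :
    ∃ a b : K, 1 < ‖a‖ ∧ ‖b‖ = 1 ∧ ((2 : K) ≠ 0 → ‖a‖ = ‖(2 : K)‖⁻¹) ∧
      ∃ U : Set (OnePoint K), IsWanderingComponent (quadRatMap a b) U ∧
        ∃ (x : K) (r : ℝ), 0 < r ∧ openDisk x r ⊆ U ∧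
          (∀ n : ℕ, ∃ (y : K) (s : ℝ), 0 < s ∧
            (quadRatMap a b)^[n] '' openDisk x r = openDisk y s) ∧
          (∀ m n : ℕ, m < n →
            Disjoint ((quadRatMap a b)^[m] '' openDisk x r)
              ((quadRatMap a b)^[n] '' openDisk x r)) := by
  obtain ⟨c, hc, hc1, h2, hc2⟩ := exists_scale (norm_two_lt_one (K := K))
  obtain ⟨κ, hN, hgood, hrad, hT⟩ := exists_param hc hc1 h2
  have hp := hN.pos
  have hB : lead c κ ≠ 0 := norm_pos_iff.1 (by rw [hN.norm_lead]; exact one_pos)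
  have ha : ‖-(lead c κ / κ)‖ = (‖c‖ ^ 2)⁻¹ := by
    rw [norm_neg, norm_div, hN.norm_lead, hN.norm_κ, one_div]
  obtain ⟨U, hU, hsub, himg, hdisj⟩ := wandering_of_orbit hN.isModel
    (fun z hz => quadRatMap_coe hB hz) (pow_pos hp 5) hgood hrad hT
  refine ⟨-(lead c κ / κ), (lead c κ)⁻¹, ?_, ?_, fun h => ?_, U, hU, startPt c κ, ‖c‖ ^ 5,
    pow_pos hp 5, hsub, himg, hdisj⟩
  · rw [ha]
    exact (one_lt_inv₀ (pow_pos hp 2)).2 (pow_lt_one₀ hp.le hc1 two_ne_zero)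
  · rw [norm_inv, hN.norm_lead, inv_one]
  · rw [ha, hc2 h]

end
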